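/- **Setting.** Let $d\ge 1$ and let $f$ be a probability density on $\mathbb R^d$ with compact support $\mathcal X$ (so $f=0$ off $\mathcal X$). $B(x,r)$ is the closed ball, $M+B(0,r)=\{x:\inf_{y\in M}\|x-y\|\le r\}$, $\mu$ is Lebesgue measure, and $L_f(\lambda)=\{x\in\mathcal X:f(x)\ge\lambda\}$. Fix $0<\beta<1$. A *cluster-core* is a closed connected set $M\subset\mathcal X$ that is a connected component of $\{x\in\mathcal X: f(x)\ge(1-\beta)\max_M f\}$. Let $M_1,\dots,M_C$ be the cluster-cores of $f$. The *attraction region* $\mathcal A_i$ is the set of $x\in\mathcal X$ whose gradient ascent curve ($\pi_x(0)=x$, $\pi_x'(t)=\nabla f(\pi_x(t))$, $\pi_x(t)\in\mathcal X$ for $t\ge 0$) exists and converges, as $t\to\infty$, to a point of $M_i$ (if there are several such curves from $x$, all of them do). For $R,\rho>0$ the *$(R,\rho)$-interior* $\mathcal A_i^{(R,\rho)}$ is the set of $x_0\in\mathcal A_i$ such that every path $\mathcal P$ from $x_0$ to any $y\in\partial\mathcal A_i$ satisfies $$\sup_{x\in\mathcal P}\ \inf_{x'\in B(x,R)}f(x')\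 \ge\ \sup_{x'\in B(y,R)}f(x')+\rho .$$ **Algorithms.** For a sample $X_{[n]}=\{x_1,\dots,x_n\}$ let $r_k(x)=\inf\{r>0:|B(x,r)\cap X_{[n]}|\ge k\}$ and $f_k(x)=k/(n\,v_d\,r_k(x)^d)$, with $v_d$ the volume of the unit ball. $G(\lambda)$ is the graph on $\{x\in X_{[n]}:f_k(x)\ge\lambda\}$ with an edge between $x,x'$ iff $\|x-x'\|\le\min\{r_k(x),r_k(x')\}$. *MCores* goes through the sample points in decreasing order of $f_k$; at $x_i$, with $\lambda=f_k(x_i)$, it adds the connected component of $G(\lambda-\beta\lambda)$ containing $x_i$ to the list of estimated cores if it is disjoint from all cores already in the list. *Quickshift++* runs MCores, draws an edge from each sample point $x$ outside the estimated cores to its closest sample point with a value of $f_k$ larger than $f_k(x)$, and assigns a sample point to the estimated core in which its directed path ends. **Assumptions.** 1. $f$ is continuously differentiable on $\mathcal X$ and $\inf_{\mathcal X}f\ge\lambda_0$ for some $\lambda_0>0$. 2. There is $R_0>0$ with $M_i+B(0,R_0)\subseteq\mathcal A_i$ for all $i$; moreover $\mu(\partial M_i)=0$ for all $i$. 3. For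 each $\epsilon>0$ there is $\eta>0$ such that for $0<\lambda\le\lambda'\le\|f\|_\infty$ with $|\lambda-\lambda'|<\eta$, every $x\in L_f(\lambda)$ at distance at least $\epsilon$ from $\partial L_f(\lambda)$ lies in $L_f(\lambda')$. 4. For each $r>0$ there is $\sigma>0$ such that for every connected component $A$ of any level set of $f$ that is contained in none of the $M_i$, $\mu(B(x,r)\cap A)\ge\sigma$ for all $x\in A$. **Theorem.** Under these assumptions let $0<R<R_0$, $\rho,\delta>0$, and let $k=k(n)\ge1$ satisfy $\log^2 n/k\to0$ and $k/n\to0$. Then for all sufficiently large $n$, with probability at least $1-2\delta$ over $n$ i.i.d. samples $X_{[n]}$ from $f$, the following holds (however ties in the algorithms are broken). If the cluster-cores returned by MCores with parameters $k,\beta$ are exactly $C$ sets $\widehat M_1,\dots,\widehat M_C$ with $$M_i\cap X_{[n]}\subseteq\widehat M_i\subseteq M_i+B(0,R/4)\qquad(i=1,\dots,C),$$ then, for every $i\in\{1,\dots,C\}$ and every $x\in\mathcal A_i^{(R,\rho)}\cap X_{[n]}$, Quickshift++ assigns $x$ to the cluster of $\widehat M_i$. -/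

import Mathlib

open Set Filter Topology MeasureTheory Metric

noncomputable section

/-! ### The density, its level sets and its cluster-cores -/

/-- `f` is a probability density with respect to Lebesgue measure, with compact support
`tsupport f`. -/
structure IsCompactDensity {d : ℕ} (f : EuclideanSpace ℝ (Fin d) → ℝ) : Prop where
  measurable : Measurable f
  nonneg : ∀ x, 0 ≤ f x
  lintegral_eq_one : ∫⁻ x, ENNReal.ofReal (f x) = 1
  compact_support : HasCompactSupport f

/-- The law with density `f`. -/
def densityLaw {d : ℕ} (f : EuclideanSpace ℝ (Fin d) → ℝ) :
    Measure (EuclideanSpace ℝ (Fin d)) :=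
  volume.withDensity fun x => ENNReal.ofReal (f x)

/-- `g` is a continuous gradient of `f` on the support of `f` (derivatives are taken within the
support, since `f` may jump to `0` across its boundary). Thus `∃ g, IsGradientOnSupport f g` says
that `f` is continuously differentiable on its support. -/
def IsGradientOnSupport {d : ℕ} (f : EuclideanSpace ℝ (Fin d) → ℝ)
    (g : EuclideanSpace ℝ (Fin d) → EuclideanSpace ℝ (Fin d)) : Prop :=
  ContinuousOn g (tsupport f) ∧ ∀ x ∈ tsupport f, HasGradientWithinAt f (g x) (tsupport f) x

/-- The level set `L_f(lam) = {x ∈ supp f : f x ≥ lam}`. -/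
def levelSet {d : ℕ} (f : EuclideanSpace ℝ (Fin d) → ℝ) (lam : ℝ) :
    Set (EuclideanSpace ℝ (Fin d)) :=
  {x | x ∈ tsupport f ∧ lam ≤ f x}

/-- `A` is a connected component of `S`. -/
def IsComponentOf {E : Type*} [TopologicalSpace E] (A S : Set E) : Prop :=
  ∃ x ∈ S, A = connectedComponentIn S x

/-- `M` is a cluster-core of `f` with fluctuation parameter `β`: a closed connected subset of the
support that is a connected component of `{x : f x ≥ (1 - β) max_M f}`. -/
def IsClusterCore {d : ℕ} (f : EuclideanSpace ℝ (Fin d) → ℝ) (β : ℝ)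
    (M : Set (EuclideanSpace ℝ (Fin d))) : Prop :=
  IsClosed M ∧ IsConnected M ∧ M ⊆ tsupport f ∧
    ∃ m : ℝ, IsGreatest (f '' M) m ∧ IsComponentOf M (levelSet f ((1 - β) * m))

/-! ### Gradient flow and attraction regions -/

/-- `π` is a gradient ascent curve in the support of `f` issued from `x`, defined for all
times `t ≥ 0`; `g` is the gradient of `f`. -/
def IsAscentPath {d : ℕ} (f : EuclideanSpace ℝ (Fin d) → ℝ)
    (g : EuclideanSpace ℝ (Fin d) → EuclideanSpace ℝ (Fin d))
    (x : EuclideanSpace ℝ (Fin d)) (π : ℝ → EuclideanSpace ℝ (Fin d)) : Prop :=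
  π 0 = x ∧ ∀ t : ℝ, 0 ≤ t → π t ∈ tsupport f ∧ HasDerivWithinAt π (g (π t)) (Ici 0) t

/-- The attraction region of `M`: the points of the support whose ascent curve converges to a
point of `M`. Where a merely continuous gradient admits several ascent curves from the same point,
all of them have to converge to a point of `M`. -/
def attractionRegion {d : ℕ} (f : EuclideanSpace ℝ (Fin d) → ℝ)
    (g : EuclideanSpace ℝ (Fin d) → EuclideanSpace ℝ (Fin d))
    (M : Set (EuclideanSpace ℝ (Fin d))) : Set (EuclideanSpace ℝ (Fin d)) :=
  {x | x ∈ tsupport f ∧ (∃ π, IsAscentPath f g x π) ∧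
    ∀ π, IsAscentPath f g x π → ∃ y ∈ M, Tendsto π atTop (𝓝 y)}

/-- The `(R, ρ)`-interior of `A`: the points `x₀` of `A` such that every path `γ` (in the whole
space) from `x₀` to any boundary point `y` of `A` satisfies
`sup_{x ∈ γ} inf_{B(x, R)} f ≥ sup_{B(y, R)} f + ρ`. -/
def regionInterior {d : ℕ} (f : EuclideanSpace ℝ (Fin d) → ℝ) (R ρ : ℝ)
    (A : Set (EuclideanSpace ℝ (Fin d))) : Set (EuclideanSpace ℝ (Fin d)) :=
  {x₀ | x₀ ∈ A ∧ ∀ y ∈ frontier A, ∀ γ : Path x₀ y,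
    sSup (f '' closedBall y R) + ρ ≤ ⨆ t, sInf (f '' closedBall (γ t) R)}

/-! ### Regularity of the level sets -/

/-- The `ε`-interior of `A`: the points of `A` at distance at least `ε` from its boundary. -/
def epsInterior {E : Type*} [MetricSpace E] (A : Set E) (ε : ℝ) : Set E :=
  {x | x ∈ A ∧ ∀ y ∈ frontier A, ε ≤ dist x y}

/-- Uniform continuity of the level sets. -/
def LevelSetsUniformlyContinuous {d : ℕ} (f : EuclideanSpace ℝ (Fin d) → ℝ) : Prop :=
  ∀ ε : ℝ, 0 < ε → ∃ η : ℝ, 0 < η ∧ ∀ lam lam' : ℝ, 0 < lam → lam ≤ lam' → lam' ≤ ⨆ x, f x →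
    |lam - lam'| < η → epsInterior (levelSet f lam) ε ⊆ levelSet f lam'

/-- Components of level sets that are not contained in one of the sets `M i` are uniformly thick
around each of their points. -/
def LevelSetsThick {d : ℕ} {ι : Type*} (f : EuclideanSpace ℝ (Fin d) → ℝ)
    (M : ι → Set (EuclideanSpace ℝ (Fin d))) : Prop :=
  ∀ r : ℝ, 0 < r → ∃ σ : ℝ, 0 < σ ∧ ∀ (lam : ℝ) (A : Set (EuclideanSpace ℝ (Fin d))),
    IsComponentOf A (levelSet f lam) → (∀ i, ¬ A ⊆ M i) →
      ∀ x ∈ A, ENNReal.ofReal σ ≤ volume (closedBall x r ∩ A)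

/-! ### The `k`-NN density estimator and the two algorithms

A sample is a map `X : Fin n → ℝ^d`; sample points are referred to by their indices (under a law
with a density they are almost surely pairwise distinct). -/

/-- The distance `r_k(x)` from `x` to its `k`-th nearest sample point. -/
def knnRadius {d n : ℕ} (X : Fin n → EuclideanSpace ℝ (Fin d)) (k : ℕ)
    (x : EuclideanSpace ℝ (Fin d)) : ℝ :=
  sInf {r : ℝ | 0 < r ∧ k ≤ Set.ncard {j : Fin n | X j ∈ closedBall x r}}

/-- The `k`-NN density estimator `f_k(x) = k / (n v_d r_k(x)^d)`. -/
def knnDensity {d n : ℕ} (X : Fin n → EuclideanSpace ℝ (Fin d)) (k : ℕ)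
    (x : EuclideanSpace ℝ (Fin d)) : ℝ :=
  (k : ℝ) / ((n : ℝ) * volume.real (ball (0 : EuclideanSpace ℝ (Fin d)) 1) * knnRadius X k x ^ d)

/-- The `lam`-level `G(lam)` of the mutual `k`-NN graph. -/
def mutualKnnGraph {d n : ℕ} (X : Fin n → EuclideanSpace ℝ (Fin d)) (k : ℕ) (lam : ℝ) :
    SimpleGraph {i : Fin n // lam ≤ knnDensity X k (X i)} where
  Adj i j := i ≠ j ∧
    dist (X i.1) (X j.1) ≤ min (knnRadius X k (X i.1)) (knnRadius X k (X j.1))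
  symm := ⟨fun i j h => ⟨h.1.symm, by rw [dist_comm, min_comm]; exact h.2⟩⟩
  loopless := ⟨fun _ h => h.1 rfl⟩

/-- The connected component of `G(lam)` that contains the sample point `i`. -/
def knnComponent {d n : ℕ} (X : Fin n → EuclideanSpace ℝ (Fin d)) (k : ℕ) (lam : ℝ)
    (i : Fin n) : Set (Fin n) :=
  {j | ∃ (hi : lam ≤ knnDensity X k (X i)) (hj : lam ≤ knnDensity X k (X j)),
    (mutualKnnGraph X k lam).Reachable ⟨i, hi⟩ ⟨j, hj⟩}

open Classical in
/-- One pass of the loop of MCores: at the sample point `i`, with `lam = f_k(x_i)`, the component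
of `G(lam - β lam)` containing `x_i` is added to the current family of cluster-cores if it is
disjoint from all of them. -/
def mcoresStep {d n : ℕ} (X : Fin n → EuclideanSpace ℝ (Fin d)) (k : ℕ) (β : ℝ)
    (cores : Set (Set (Fin n))) (i : Fin n) : Set (Set (Fin n)) :=
  let lam := knnDensity X k (X i)
  let A := knnComponent X k (lam - β * lam) i
  if ∀ B ∈ cores, Disjoint A B then insert A cores else cores

/-- MCores, run through the sample points in the order `τ 0, τ 1, …, τ (n - 1)`. -/
def mcores {d n : ℕ} (X : Fin n → EuclideanSpace ℝ (Fin d)) (k : ℕ) (β : ℝ)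
    (τ : Equiv.Perm (Fin n)) : Set (Set (Fin n)) :=
  (List.ofFn τ).foldl (mcoresStep X k β) ∅

/-- `τ` sorts the sample points by decreasing value of `f_k` (ties are broken arbitrarily). -/
def SortsByKnnDensity {d n : ℕ} (X : Fin n → EuclideanSpace ℝ (Fin d)) (k : ℕ)
    (τ : Equiv.Perm (Fin n)) : Prop :=
  Antitone fun i => knnDensity X k (X (τ i))

/-- `j` is a closest sample point to `i` among those with a higher value of `f_k`. -/
def IsClosestHigher {d n : ℕ} (X : Fin n → EuclideanSpace ℝ (Fin d)) (k : ℕ)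
    (i j : Fin n) : Prop :=
  knnDensity X k (X i) < knnDensity X k (X j) ∧
    ∀ l, knnDensity X k (X i) < knnDensity X k (X l) → dist (X i) (X j) ≤ dist (X i) (X l)

/-- `G` is the directed graph built by Quickshift++ from the estimated cluster-cores `cores`
(ties between closest points are broken arbitrarily): a point of a core has no outgoing edge, and
any other point has exactly one, to a closest sample point with a higher value of `f_k`. -/
def IsQuickshiftGraph {d n : ℕ} (X : Fin n → EuclideanSpace ℝ (Fin d)) (k : ℕ)
    (cores : Set (Set (Fin n))) (G : Fin n → Fin n → Prop) : Prop :=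
  ∀ i, ((∃ B ∈ cores, i ∈ B) → ∀ j, ¬ G i j) ∧
    ((¬ ∃ B ∈ cores, i ∈ B) → ∃ j, IsClosestHigher X k i j ∧ ∀ l, G i l ↔ l = j)

/-- The cluster that Quickshift++ attaches to the estimated core `B`: the sample points whose
directed path in `G` ends in `B`. -/
def quickshiftCluster {n : ℕ} (G : Fin n → Fin n → Prop) (B : Set (Fin n)) : Set (Fin n) :=
  {i | ∃ j ∈ B, Relation.ReflTransGen G i j}

end

/-! The argument separates a deterministic statement from a probabilistic one.

Deterministic: by compactness there is one `η > 0` such that every point outside the cores and well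
inside an attraction region has, within `R / 8`, a point where `f` is larger by `η`
(`exists_uniform_increase`). Otherwise a limit of bad points would be a local maximum, hence
stationary, hence in a core; it would be approximated by points outside all cores, and the
regularity of the level sets excludes this. If `f_k` is close to `f` and the sample is dense, a
Quickshift edge leaving such a sample point therefore has length at most `R / 4`. Concatenating
edges gives a path from the starting point along which `f_k` increases. Were it to come within `R /
2` of the boundary of the attraction region, it would extend to a path reaching the boundary without
the peak of height `ρ` that the `(R, ρ)`-interior demands (`closedBall_subset_of_path`). So the walk
stays in the region, and the only estimated core it can end in is that of the region
(`IsRepresentative.mem_quickshiftCluster`).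

Probabilistic: the required closeness and density hold with probability tending to 1
(`IsCompactDensity.tendsto_measure_not_isRepresentative`). Chernoff's bound, conditionally on the
centre of the ball, gives errors `q ^ k` with `q < 1`; a union bound over `n` centres is affordable
since `log² n / k → 0`. -/

/-! ### Connectedness lemmas. -/

/-- A decreasing sequence of compact preconnected sets has a preconnected intersection. -/
theorem isPreconnected_iInter_of_antitone {E : Type*} [TopologicalSpace E] [T2Space E]
    {A : ℕ → Set E} (hA : Antitone A) (hc : ∀ n, IsCompact (A n))
    (hp : ∀ n, IsPreconnected (A n)) : IsPreconnected (⋂ n, A n) := by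
  have hcomp : IsCompact (⋂ n, A n) := 
    (hc 0).of_isClosed_subset (isClosed_iInter fun n => (hc n).isClosed) (iInter_subset _ 0)
  rw [isPreconnected_iff_subset_of_fully_disjoint_closed hcomp.isClosed]
  intro u v hu hv huv hd
  obtain ⟨U, V, hU, hV, hKU, hKV, hUV⟩ := SeparatedNhds.of_isCompact_isCompact
    (hcomp.inter_right hu) (hcomp.inter_right hv)
    (hd.mono inter_subset_right inter_subset_right)
  obtain ⟨n, hn⟩ := exists_subset_nhds_of_isCompact (U := U ∪ V) hA.directed_ge hc (by
    intro x hx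
    refine (hU.union hV).mem_nhds ?_
    rcases huv hx with h | h
    · exact Or.inl (hKU ⟨hx, h⟩)
    · exact Or.inr (hKV ⟨hx, h⟩))
  have hsub : (⋂ n, A n) ⊆ A n := iInter_subset _ _
  rcases (hp n).subset_or_subset hU hV hUV hn with h | h
  · left
    intro x hx
    rcases huv hx with h' | h'
    · exact h'
    · exact (disjoint_left.1 hUV (h (hsub hx)) (hKV ⟨hx, h'⟩)).elim
  · right
    intro x hx
    rcases huv hx with h' | h'
    · exact (disjoint_left.1 hUV (hKU ⟨hx, h'⟩) (h (hsub hx))).elim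
    · assumption

/-- A preconnected set that meets a set and its complement meets its frontier. -/
theorem IsPreconnected.exists_mem_frontier {E : Type*} [TopologicalSpace E] {s A : Set E}
    (hs : IsPreconnected s) {x y : E} (hx : x ∈ s) (hxA : x ∈ A) (hy : y ∈ s) (hyA : y ∉ A) :
    ∃ z ∈ s, z ∈ frontier A := by
  by_contra! h
  have hsub : s ⊆ interior A ∪ (closure A)ᶜ := by
    intro z hz
    by_cases hzA : z ∈ closure A
    · left
      by_contra hi
      exact h z hz ⟨hzA, hi⟩
    · exact Or.inr hzA
  have hd : Disjoint (interior A) (closure A)ᶜ :=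
    disjoint_compl_right.mono_left (interior_subset.trans subset_closure)
  rcases hs.subset_or_subset isOpen_interior isClosed_closure.isOpen_compl hd hsub with h' | h'
  · exact hyA (interior_subset (h' hy))
  · exact h' hx (subset_closure hxA)

/-! ### Cluster-cores, attraction regions and the uniform increase of the density. -/

section
variable {d : ℕ} {f : EuclideanSpace ℝ (Fin d) → ℝ}
  {g : EuclideanSpace ℝ (Fin d) → EuclideanSpace ℝ (Fin d)}

theorem IsGradientOnSupport.continuousOn (hg : IsGradientOnSupport f g) :
    ContinuousOn f (tsupport f) := fun x hx => (hg.2 x hx).continuousWithinAt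

theorem IsCompactDensity.bddAbove (hf : IsCompactDensity f) (hcont : ContinuousOn f (tsupport f)) :
    ∃ B : ℝ, 0 < B ∧ ∀ x, f x ≤ B := by
  obtain ⟨B, hB⟩ := (hf.compact_support.isCompact.image_of_continuousOn hcont).bddAbove
  refine ⟨max B 1, by positivity, fun x => ?_⟩
  by_cases hx : x ∈ tsupport f
  · exact le_max_of_le_left (hB ⟨x, hx, rfl⟩)
  · rw [image_eq_zero_of_notMem_tsupport hx]; positivity

theorem isCompact_levelSet (hf : IsCompactDensity f) (hcont : ContinuousOn f (tsupport f))
    (lam : ℝ) : IsCompact (levelSet f lam) := by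
  have : IsClosed (tsupport f ∩ f ⁻¹' Ici lam) :=
    hcont.preimage_isClosed_of_isClosed (isClosed_tsupport f) isClosed_Ici
  exact hf.compact_support.isCompact.of_isClosed_subset this fun x hx => hx.1

theorem levelSet_antitone : Antitone (levelSet f) :=
  fun _ _ h _ hx => ⟨hx.1, h.trans hx.2⟩

theorem isClosed_connectedComponentIn {E : Type*} [TopologicalSpace E] {F : Set E}
    (hF : IsClosed F) (x : E) : IsClosed (connectedComponentIn F x) := by
  by_cases hx : x ∈ F
  · refine isClosed_of_closure_subset ?_
    exact isPreconnected_connectedComponentIn.closure.subset_connectedComponentIn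
      (subset_closure (mem_connectedComponentIn hx))
      (closure_minimal (connectedComponentIn_subset F x) hF)
  · rw [connectedComponentIn_eq_empty hx]; exact isClosed_empty

/-- Two cluster-cores that meet coincide. -/
theorem IsClusterCore.eq_of_inter_nonempty {β : ℝ} (hβ : β < 1)
    {M M' : Set (EuclideanSpace ℝ (Fin d))} (h : IsClusterCore f β M) (h' : IsClusterCore f β M')
    (hne : (M ∩ M').Nonempty) : M = M' := by
  wlog hle : ∃ m m', IsGreatest (f '' M) m ∧ IsGreatest (f '' M') m' ∧ m ≤ m' generalizing M M'
  · obtain ⟨-, -, -, m, hm, -⟩ := id h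
    obtain ⟨-, -, -, m', hm', -⟩ := id h'
    rcases le_total m m' with h1 | h1
    · exact (hle ⟨m, m', hm, hm', h1⟩).elim
    · exact (this h' h (by rwa [inter_comm]) ⟨m', m, hm', hm, h1⟩).symm
  obtain ⟨m, m', hm, hm', hmm⟩ := hle
  obtain ⟨-, -, -, m₁, hm₁, x, hx, hMx⟩ := h
  obtain ⟨-, -, -, m₂, hm₂, y, hy, hMy⟩ := h'
  obtain rfl := hm.unique hm₁
  obtain rfl := hm'.unique hm₂
  obtain ⟨z, hz, hz'⟩ := hne
  rw [hMx] at hz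
  rw [hMy] at hz'
  have e1 := connectedComponentIn_eq hz
  have e2 := connectedComponentIn_eq hz'
  -- The core with the larger maximum is cut at the higher level, so it lies in the other one; this
  -- forces the maxima, hence the levels, to agree.
  have hsub : M' ⊆ M := by
    rw [hMx, hMy, e1, e2]
    apply connectedComponentIn_mono
    exact levelSet_antitone (by nlinarith)
  have : m' ≤ m := by
    obtain ⟨w, hw, rfl⟩ := hm'.1
    exact hm.2 ⟨w, hsub hw, rfl⟩
  have hmm' : m = m' := le_antisymm hmm this
  rw [hMx, hMy, e1, e2, hmm']

theorem attractionRegion_subset {M : Set (EuclideanSpace ℝ (Fin d))} :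
    attractionRegion f g M ⊆ tsupport f := fun _ h => h.1

/-- An ascent curve from a common point has a single limit, which must lie in both sets. This tells
attraction regions of distinct cores apart. -/
theorem inter_nonempty_of_mem_attractionRegion {M M' : Set (EuclideanSpace ℝ (Fin d))}
    {x : EuclideanSpace ℝ (Fin d)} (h : x ∈ attractionRegion f g M)
    (h' : x ∈ attractionRegion f g M') : (M ∩ M').Nonempty := by
  obtain ⟨-, ⟨π, hπ⟩, hall⟩ := h
  obtain ⟨y, hy, hty⟩ := hall π hπ
  obtain ⟨y', hy', hty'⟩ := h'.2.2 π hπ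
  exact ⟨y, hy, by rwa [tendsto_nhds_unique hty hty']⟩

/-- A local maximum in the interior of an attraction region belongs to the attracting set. -/
theorem mem_of_isLocalMax (hg : IsGradientOnSupport f g) {M : Set (EuclideanSpace ℝ (Fin d))}
    {x : EuclideanSpace ℝ (Fin d)} (hx : attractionRegion f g M ∈ 𝓝 x) (hmax : IsLocalMax f x) :
    x ∈ M := by
  have hxA := mem_of_mem_nhds hx
  have hX : tsupport f ∈ 𝓝 x := mem_of_superset hx attractionRegion_subset
  have h1 : HasFDerivAt f (InnerProductSpace.toDual ℝ _ (g x)) x :=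
    (hg.2 x hxA.1).hasFDerivWithinAt.hasFDerivAt hX
  have hz : g x = 0 := by
    simpa using hmax.hasFDerivAt_eq_zero h1
  -- At a stationary point the constant curve is an ascent curve, and its limit is `x` itself.
  obtain ⟨y, hy, hty⟩ := hxA.2.2 (fun _ => x) ⟨rfl, fun t _ => ⟨hxA.1, by
    rw [hz]; exact hasDerivWithinAt_const _ _ _⟩⟩
  rwa [tendsto_nhds_unique tendsto_const_nhds hty]

/-- A subset of a non-maximal level set lies in its own frontier wherever the density does not
exceed the level. -/
theorem inter_subset_frontier_of_le_level (hf : IsCompactDensity f)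
    (hcont : ContinuousOn f (tsupport f)) (hlev : LevelSetsUniformlyContinuous f)
    {lam m : ℝ} (hlam : 0 < lam) (hlt : lam < m) {M : Set (EuclideanSpace ℝ (Fin d))}
    (hm : IsGreatest (f '' M) m) (hM : M ⊆ levelSet f lam) {U : Set (EuclideanSpace ℝ (Fin d))}
    (hU : ∀ y ∈ U, f y ≤ lam) : U ∩ M ⊆ frontier M := by
  rintro p ⟨hpU, hpM⟩
  refine ⟨subset_closure hpM, fun hpi => ?_⟩
  have hpi' : p ∈ interior (levelSet f lam) := interior_mono hM hpi
  obtain ⟨ε, hε, hball⟩ := Metric.isOpen_iff.1 isOpen_interior p hpi'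
  obtain ⟨η, hη, H⟩ := hlev ε hε
  obtain ⟨B, -, hB⟩ := hf.bddAbove hcont
  have hmB : m ≤ ⨆ x, f x := by
    obtain ⟨w, -, rfl⟩ := hm.1
    exact le_ciSup (f := f) ⟨B, by rintro _ ⟨x, rfl⟩; exact hB x⟩ w
  -- Near an interior point, uniform continuity of the level sets applies with a level strictly
  -- above `lam`; the cap `m` keeps that level below the supremum of `f`.
  have := H lam (min (lam + η / 2) m) hlam (le_min (by linarith) hlt.le)
    ((min_le_right _ _).trans hmB) (by
      rw [abs_sub_comm, abs_of_nonneg]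
      · have := min_le_left (lam + η / 2) m; linarith
      · have : lam ≤ min (lam + η / 2) m := le_min (by linarith) hlt.le
        linarith)
    (a := p) ⟨hM hpM, fun y hy => by
      by_contra! hlt'
      exact hy.2 (hball (by rwa [mem_ball, dist_comm]))⟩
  have h1 : lam < min (lam + η / 2) m := lt_min (by linarith) hlt
  exact absurd (hU p hpU) (not_le.2 (h1.trans_le this.2))

/-- Away from the cluster-cores and inside an attraction region, the density takes uniformly larger
values at nearby points. -/
theorem exists_uniform_increase (hf : IsCompactDensity f) (hg : IsGradientOnSupport f g)
    {lam₀ : ℝ} (hlam₀ : 0 < lam₀) (hlower : ∀ x ∈ tsupport f, lam₀ ≤ f x)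
    {β : ℝ} (hβ₀ : 0 < β) (hβ₁ : β < 1) {ι : Type*} {M : ι → Set (EuclideanSpace ℝ (Fin d))}
    (hM : ∀ i, IsClusterCore f β (M i)) (hM_null : ∀ i, volume (frontier (M i)) = 0)
    (hlev : LevelSetsUniformlyContinuous f) (hthick : LevelSetsThick f M)
    {r : ℝ} (hr : 0 < r) :
    ∃ η : ℝ, 0 < η ∧ ∀ i x, closedBall x (2 * r) ⊆ attractionRegion f g (M i) →
      (∀ j, x ∉ M j) → ∃ y ∈ closedBall x r, f x + η ≤ f y := by
  have hcont := hg.continuousOn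
  by_contra! hcon
  choose i u hu hnot hlt using fun n : ℕ => hcon (1 / ((n : ℝ) + 1)) (by positivity)
  have huX : ∀ n, u n ∈ tsupport f := fun n =>
    attractionRegion_subset (hu n (mem_closedBall_self (by positivity)))
  obtain ⟨x, hxX, φ, hφ, hlim⟩ := hf.compact_support.isCompact.tendsto_subseq huX
  have hflim : Tendsto (fun n => f (u (φ n))) atTop (𝓝 (f x)) :=
    (hcont x hxX).tendsto.comp (tendsto_nhdsWithin_iff.2 ⟨hlim, Eventually.of_forall fun n =>
      huX (φ n)⟩)
  have hlim' : Tendsto (fun n => f (u (φ n)) + 1 / ((φ n : ℝ) + 1)) atTop (𝓝 (f x)) := by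
    simpa using hflim.add (tendsto_one_div_add_atTop_nhds_zero_nat.comp hφ.tendsto_atTop)
  have hmax : ∀ y ∈ ball x r, f y ≤ f x := by
    intro y hy
    refine ge_of_tendsto hlim' ?_
    filter_upwards [(hlim.dist tendsto_const_nhds).eventually (gt_mem_nhds (show dist x y < r by
      rwa [dist_comm]))] with n hn
    exact (hlt (φ n) y (by rw [mem_closedBall, dist_comm]; exact hn.le)).le
  -- The radius `2 * r` in the hypothesis is spent here: half on the distance from `u (φ n)` to its
  -- limit, half on the ball around the limit.
  obtain ⟨i₀, hi₀⟩ : ∃ i₀, ball x r ⊆ attractionRegion f g (M i₀) := by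
    obtain ⟨n, hn⟩ := (hlim.eventually (ball_mem_nhds x hr)).exists
    refine ⟨i (φ n), fun y hy => hu (φ n) ?_⟩
    rw [mem_closedBall]
    have h1 : dist y x < r := hy
    have h2 : dist (u (φ n)) x < r := hn
    have := dist_triangle_right y (u (φ n)) x
    linarith
  have hnhds : attractionRegion f g (M i₀) ∈ 𝓝 x := mem_of_superset (ball_mem_nhds x hr) hi₀
  have hballX : ball x r ⊆ tsupport f := hi₀.trans attractionRegion_subset
  have hxM : x ∈ M i₀ := mem_of_isLocalMax hg hnhds
    (mem_of_superset (ball_mem_nhds x hr) hmax)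
  obtain ⟨-, -, hMX, m, hm, x₀, hx₀, hMeq⟩ := hM i₀
  have hm0 : 0 < m := by
    obtain ⟨w, hw, rfl⟩ := hm.1
    exact hlam₀.trans_le (hlower w (hMX hw))
  have hlam : 0 < (1 - β) * m := mul_pos (by linarith) hm0
  have hMeq' : M i₀ = connectedComponentIn (levelSet f ((1 - β) * m)) x := by
    rw [hMeq] at hxM ⊢; exact connectedComponentIn_eq hxM
  have hMlev : M i₀ ⊆ levelSet f ((1 - β) * m) := by
    rw [hMeq]; exact connectedComponentIn_subset _ _
  -- points close to `x` lie in the components around `x` of lower level sets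
  have key : ∀ lam < f x, ∃ n, u n ∈ connectedComponentIn (levelSet f lam) x := by
    intro lam hlamx
    have h1 : levelSet f lam ∈ 𝓝 x := by
      have hX : tsupport f ∈ 𝓝 x := mem_of_superset (ball_mem_nhds x hr) hballX
      filter_upwards [hX, (hcont.continuousAt hX).eventually (lt_mem_nhds hlamx)] with y h2 h3
      exact ⟨h2, h3.le⟩
    -- Euclidean space is locally connected, so the component of a neighbourhood of `x` is again a
    -- neighbourhood of `x`.
    obtain ⟨n, hn⟩ := (hlim.eventually (connectedComponentIn_mem_nhds h1)).exists
    exact ⟨φ n, hn⟩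
  rcases lt_or_eq_of_le (hMlev hxM).2 with hgt | heq
  · obtain ⟨n, hn⟩ := key _ hgt
    rw [← hMeq'] at hn
    exact hnot n i₀ hn
  -- Critical case: `x` lies exactly at the level of its core. The components `A n` around `x` at
  -- levels increasing to `f x` each contain some `u l`, so they lie in no core and are thick; their
  -- intersection lies in the core, and near `x` even in its null frontier.
  · obtain ⟨σ, hσ, hvol⟩ := hthick (r / 2) (by positivity)
    set A : ℕ → Set (EuclideanSpace ℝ (Fin d)) := fun n =>
      connectedComponentIn (levelSet f (f x - 1 / ((n : ℝ) + 1))) x with hAdef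
    have hlevlt : ∀ n : ℕ, f x - 1 / ((n : ℝ) + 1) < f x := fun n => by
      have : (0 : ℝ) < 1 / ((n : ℝ) + 1) := by positivity
      linarith
    have hxlev : ∀ n : ℕ, x ∈ levelSet f (f x - 1 / ((n : ℝ) + 1)) := fun n =>
      ⟨hxX, (hlevlt n).le⟩
    have hAanti : Antitone A := by
      intro a b hab
      refine connectedComponentIn_mono _ (levelSet_antitone ?_)
      have := Nat.one_div_le_one_div (α := ℝ) hab
      linarith
    have hAc : ∀ n, IsCompact (A n) := fun n =>
      (isCompact_levelSet hf hcont _).of_isClosed_subset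
        (isClosed_connectedComponentIn (isCompact_levelSet hf hcont _).isClosed x)
        (connectedComponentIn_subset _ _)
    have hAvol : ∀ n, ENNReal.ofReal σ ≤ volume (closedBall x (r / 2) ∩ A n) := by
      intro n
      refine hvol _ (A n) ⟨x, hxlev n, rfl⟩ (fun j hj => ?_) x (mem_connectedComponentIn (hxlev n))
      obtain ⟨l, hl⟩ := key _ (hlevlt n)
      exact hnot l j (hj hl)
    have hinter : (⋂ n, A n) ⊆ M i₀ := by
      rw [hMeq']
      refine (isPreconnected_iInter_of_antitone hAanti hAc
        fun n => isPreconnected_connectedComponentIn).subset_connectedComponentIn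
        (mem_iInter.2 fun n => mem_connectedComponentIn (hxlev n)) fun y hy => ?_
      have hy' : ∀ n : ℕ, y ∈ levelSet f (f x - 1 / ((n : ℝ) + 1)) := fun n =>
        connectedComponentIn_subset _ _ (mem_iInter.1 hy n)
      refine ⟨(hy' 0).1, ?_⟩
      rw [heq]
      have : Tendsto (fun n : ℕ => f x - 1 / ((n : ℝ) + 1)) atTop (𝓝 (f x)) := by
        simpa using tendsto_const_nhds.sub (tendsto_one_div_add_atTop_nhds_zero_nat (𝕜 := ℝ))
      exact le_of_tendsto' this fun n => (hy' n).2
    have hlimvol : Tendsto (fun n => volume (closedBall x (r / 2) ∩ A n)) atTop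
        (𝓝 (volume (⋂ n, closedBall x (r / 2) ∩ A n))) :=
      tendsto_measure_iInter_atTop
        (fun n => (isClosed_closedBall.inter (hAc n).isClosed).nullMeasurableSet)
        (fun a b hab => inter_subset_inter_right _ (hAanti hab))
        ⟨0, ((measure_mono inter_subset_right).trans_lt (hAc 0).measure_lt_top).ne⟩
    have h1 : ENNReal.ofReal σ ≤ volume (⋂ n, closedBall x (r / 2) ∩ A n) :=
      ge_of_tendsto' hlimvol hAvol
    have h2 : (⋂ n, closedBall x (r / 2) ∩ A n) ⊆ frontier (M i₀) := by
      rw [← inter_iInter]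
      refine (inter_subset_inter (closedBall_subset_ball (by linarith : r / 2 < r)) hinter).trans ?_
      exact inter_subset_frontier_of_le_level hf hcont hlev hlam (by nlinarith) hm hMlev
        fun y hy => by rw [heq]; exact hmax y hy
    have h3 := h1.trans (measure_mono h2)
    rw [hM_null i₀] at h3
    exact absurd h3 (not_le.2 (ENNReal.ofReal_pos.2 hσ))

end

/-! ### Quickshift++ on a representative sample. -/

section
variable {d : ℕ} {f : EuclideanSpace ℝ (Fin d) → ℝ}
  {g : EuclideanSpace ℝ (Fin d) → EuclideanSpace ℝ (Fin d)}

theorem IsCompactDensity.sInf_image_le (hf : IsCompactDensity f)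
    {S : Set (EuclideanSpace ℝ (Fin d))} {x : EuclideanSpace ℝ (Fin d)} (hx : x ∈ S) :
    sInf (f '' S) ≤ f x :=
  csInf_le ⟨0, by rintro _ ⟨y, -, rfl⟩; exact hf.nonneg y⟩ ⟨x, hx, rfl⟩

theorem dist_le_of_mem_segment {E : Type*} [NormedAddCommGroup E] [NormedSpace ℝ E] {x y z : E}
    {r : ℝ} (hxy : dist x y ≤ r) (hz : z ∈ segment ℝ x y) : dist z x ≤ r ∧ dist z y ≤ r :=
  ⟨(convex_closedBall x r).segment_subset
      (mem_closedBall_self (dist_nonneg.trans hxy)) (mem_closedBall'.2 hxy) hz,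
    (convex_closedBall y r).segment_subset (mem_closedBall.2 hxy)
      (mem_closedBall_self (dist_nonneg.trans hxy)) hz⟩

/-- A point of `A` that is reached from the `(R, ρ)`-interior of `A` by a path along which the
density never dominates the value at the endpoint is far from the frontier of `A`. -/
theorem closedBall_subset_of_path (hf : IsCompactDensity f) {B : ℝ} (hB : ∀ x, f x ≤ B)
    {R ρ : ℝ} (hR : 0 < R) (hρ : 0 < ρ) {A : Set (EuclideanSpace ℝ (Fin d))}
    {x₀ x : EuclideanSpace ℝ (Fin d)} (hx₀ : x₀ ∈ regionInterior f R ρ A) (hx : x ∈ A)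
    (γ : Path x₀ x) (hγ : ∀ t, sInf (f '' closedBall (γ t) R) ≤ f x + ρ / 2) :
    closedBall x (R / 2) ⊆ A := by
  intro w hw
  by_contra hwA
  obtain ⟨y, hys, hy⟩ := (convex_segment x w).isPreconnected.exists_mem_frontier
    (left_mem_segment ℝ x w) hx (right_mem_segment ℝ x w) hwA
  have hxy : dist x y ≤ R / 2 := by
    rw [dist_comm]
    exact (dist_le_of_mem_segment (mem_closedBall'.1 hw) hys).1
  have hbdd : BddAbove (f '' closedBall y R) := ⟨B, by rintro _ ⟨z, -, rfl⟩; exact hB z⟩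
  have hsup := hx₀.2 y hy (γ.trans (Path.segment x y))
  obtain ⟨t, ht⟩ := exists_lt_of_lt_ciSup
    (lt_of_lt_of_le (show sSup (f '' closedBall y R) + ρ / 2 < _ by linarith) hsup)
  have hmem : γ.trans (Path.segment x y) t ∈ range γ ∪ segment ℝ x y := by
    rw [← Path.range_segment, ← Path.trans_range]
    exact mem_range_self t
  -- Along `γ` the infima are at most `f x + ρ / 2` and `x` lies in the `R`-ball of `y`; along the
  -- segment `y` lies in every `R`-ball. Neither part can supply the required peak.
  rcases hmem with ⟨s, hs⟩ | hs
  · rw [← hs] at ht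
    have h1 : f x ≤ sSup (f '' closedBall y R) :=
      le_csSup hbdd ⟨x, mem_closedBall.2 (by linarith), rfl⟩
    linarith [hγ s]
  · have h1 : f y ≤ sSup (f '' closedBall y R) :=
      le_csSup hbdd ⟨y, mem_closedBall_self hR.le, rfl⟩
    have h2 := hf.sInf_image_le (S := closedBall (γ.trans (Path.segment x y) t) R) (x := y)
      (by rw [mem_closedBall']; linarith [(dist_le_of_mem_segment hxy hs).2])
    linarith

/-- The sample `X` is `(k, ε, r)`-representative of `f`: at its points the `k`-NN estimator is
`ε`-accurate from above, and from below if they are `r`-deep in the support, and each `r`-deep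
point of the support has a sample point within distance `r`. -/
structure IsRepresentative {n : ℕ} (f : EuclideanSpace ℝ (Fin d) → ℝ) (k : ℕ) (ε r : ℝ)
    (X : Fin n → EuclideanSpace ℝ (Fin d)) : Prop where
  knnDensity_le : ∀ j, X j ∈ tsupport f → knnDensity X k (X j) ≤ f (X j) + ε
  le_knnDensity : ∀ j, closedBall (X j) r ⊆ tsupport f → f (X j) - ε ≤ knnDensity X k (X j)
  exists_dist_le : ∀ y, closedBall y r ⊆ tsupport f → ∃ j, dist (X j) y ≤ r

/-- Quickshift moves from a point deep in an attraction region by a short step. -/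
theorem IsRepresentative.dist_le_of_isClosestHigher {n k : ℕ} {ε r η R : ℝ}
    {X : Fin n → EuclideanSpace ℝ (Fin d)} (hX : IsRepresentative f k ε r X)
    (hr : 0 < r) (hrR : r ≤ R / 16) (hε : 0 < ε) (hεη : ε ≤ η / 4)
    (huc : ∀ x ∈ tsupport f, ∀ y ∈ tsupport f, dist x y ≤ r → |f x - f y| ≤ ε)
    {i j : Fin n} (hi : closedBall (X i) (R / 2) ⊆ tsupport f)
    {y : EuclideanSpace ℝ (Fin d)} (hy : y ∈ closedBall (X i) (R / 8)) (hfy : f (X i) + η ≤ f y)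
    (hij : IsClosestHigher X k i j) : dist (X i) (X j) ≤ R / 4 := by
  have hy' : dist y (X i) ≤ R / 8 := hy
  have hyX : closedBall y r ⊆ tsupport f := fun z hz => hi (by
    have h1 : dist z y ≤ r := hz
    have := dist_triangle z y (X i)
    rw [mem_closedBall]; linarith)
  obtain ⟨l, hl⟩ := hX.exists_dist_le y hyX
  have hil : dist (X l) (X i) ≤ R / 8 + r := by
    have := dist_triangle (X l) y (X i); linarith
  have hlX : closedBall (X l) r ⊆ tsupport f := fun z hz => hi (by
    have h1 : dist z (X l) ≤ r := hz
    have := dist_triangle z (X l) (X i)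
    rw [mem_closedBall]; linarith)
  have h1 := hX.le_knnDensity l hlX
  have h2 := hX.knnDensity_le i (hi (mem_closedBall_self (by linarith)))
  have h3 := abs_le.1 (huc (X l) (hlX (mem_closedBall_self hr.le)) y
    (hyX (mem_closedBall_self hr.le)) hl)
  -- Three errors `ε` intervene (two from the estimator, one from moving `y` to `X l`), and `3 * ε <
  -- η`. So `l` competes for the edge, at distance at most `R / 8 + R / 16`.
  have h4 := hij.2 l (by linarith)
  rw [dist_comm (X i) (X l)] at h4
  linarith

/-- On a representative sample, Quickshift++ assigns the sample points of the interior of an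
attraction region to the corresponding estimated core. -/
theorem IsRepresentative.mem_quickshiftCluster (hf : IsCompactDensity f) {B : ℝ}
    (hB : ∀ x, f x ≤ B) {β : ℝ} (hβ : β < 1) {ι : Type*}
    {M : ι → Set (EuclideanSpace ℝ (Fin d))} (hMinj : Function.Injective M)
    (hM : ∀ i, IsClusterCore f β (M i))
    {R ρ η ε r : ℝ} (hR : 0 < R) (hρ : 0 < ρ)
    (hattr : ∀ i, cthickening (R / 4) (M i) ⊆ attractionRegion f g (M i))
    (hη : ∀ i x, closedBall x (2 * (R / 8)) ⊆ attractionRegion f g (M i) →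
      (∀ j, x ∉ M j) → ∃ y ∈ closedBall x (R / 8), f x + η ≤ f y)
    (hr : 0 < r) (hrR : r ≤ R / 16) (hε : 0 < ε) (hεη : ε ≤ η / 4) (hερ : ε ≤ ρ / 4)
    (huc : ∀ x ∈ tsupport f, ∀ y ∈ tsupport f, dist x y ≤ r → |f x - f y| ≤ ε)
    {n k : ℕ} {X : Fin n → EuclideanSpace ℝ (Fin d)} (hX : IsRepresentative f k ε r X)
    {cores : Set (Set (Fin n))} {Mhat : ι → Set (Fin n)} (hcores : range Mhat = cores)
    (hMhat : ∀ i, {j | X j ∈ M i} ⊆ Mhat i ∧ ∀ j ∈ Mhat i, X j ∈ cthickening (R / 4) (M i))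
    {G : Fin n → Fin n → Prop} (hG : IsQuickshiftGraph X k cores G) {i : ι} {j₀ : Fin n}
    (hj₀ : X j₀ ∈ regionInterior f R ρ (attractionRegion f g (M i))) :
    j₀ ∈ quickshiftCluster G (Mhat i) := by
  set A := attractionRegion f g (M i) with hA
  -- The path invariant compares with `f_k`, not `f`: since `f_k` increases along edges, the errors
  -- `ε` do not accumulate.
  suffices H : ∀ a : Fin n, X a ∈ A → (∃ γ : Path (X j₀) (X a),
      ∀ t, sInf (f '' closedBall (γ t) R) ≤ knnDensity X k (X a) + ε) →
      a ∈ quickshiftCluster G (Mhat i) by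
    have hball := closedBall_subset_of_path hf hB hR hρ hj₀ hj₀.1 (Path.refl _) (fun t => by
      have := hf.sInf_image_le (S := closedBall (Path.refl (X j₀) t) R) (x := X j₀)
        (mem_closedBall_self hR.le)
      linarith)
    refine H j₀ hj₀.1 ⟨Path.refl _, fun t => ?_⟩
    have h1 := hf.sInf_image_le (S := closedBall (Path.refl (X j₀) t) R) (x := X j₀)
        (mem_closedBall_self hR.le)
    have h2 := hX.le_knnDensity j₀ (((closedBall_subset_closedBall (by linarith)).trans
      hball).trans attractionRegion_subset)
    linarith
  have hwf : WellFounded fun a b : Fin n => knnDensity X k (X b) < knnDensity X k (X a) := by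
    have : IsTrans (Fin n) fun a b => knnDensity X k (X b) < knnDensity X k (X a) :=
      ⟨fun a b c h1 h2 => h2.trans h1⟩
    have : Std.Irrefl fun a b : Fin n => knnDensity X k (X b) < knnDensity X k (X a) :=
      ⟨fun a h => lt_irrefl _ h⟩
    exact Finite.wellFounded_of_trans_of_irrefl _
  intro a
  induction a using hwf.induction with
  | _ a ih =>
  rintro haA ⟨γ, hγ⟩
  have hafk := hX.knnDensity_le a (attractionRegion_subset haA)
  have hball : closedBall (X a) (R / 2) ⊆ A :=
    closedBall_subset_of_path hf hB hR hρ hj₀ haA γ fun t => by linarith [hγ t]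
  by_cases hcore : ∃ S ∈ cores, a ∈ S
  · obtain ⟨S, hS, haS⟩ := hcore
    rw [← hcores] at hS
    obtain ⟨i', rfl⟩ := hS
    -- Any estimated core lies in the attraction region of its own true core, so the one reached
    -- here can only be that of `i`.
    have hmem := hattr i' ((hMhat i').2 a haS)
    have : M i' = M i := (hM i').eq_of_inter_nonempty hβ (hM i)
      (inter_nonempty_of_mem_attractionRegion hmem haA)
    rw [hMinj this] at haS
    exact ⟨a, haS, Relation.ReflTransGen.refl⟩
  · obtain ⟨b, hab, hGb⟩ := (hG a).2 hcore
    have hnot : ∀ j, X a ∉ M j := fun j hj =>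
      hcore ⟨Mhat j, hcores ▸ mem_range_self j, (hMhat j).1 hj⟩
    obtain ⟨y, hy, hfy⟩ := hη i (X a)
      ((closedBall_subset_closedBall (by linarith)).trans hball) hnot
    have hdist := hX.dist_le_of_isClosestHigher hr hrR hε hεη huc
      (hball.trans attractionRegion_subset) hy hfy hab
    have hbA : X b ∈ A := hball (mem_closedBall'.2 (by linarith))
    have hafk' := hX.le_knnDensity a (((closedBall_subset_closedBall (by linarith)).trans
      hball).trans attractionRegion_subset)
    obtain ⟨c, hc, hbc⟩ := ih b hab.1 hbA ⟨γ.trans (Path.segment _ _), fun t => by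
      have hmem : γ.trans (Path.segment (X a) (X b)) t ∈ range γ ∪ segment ℝ (X a) (X b) := by
        rw [← Path.range_segment, ← Path.trans_range]
        exact mem_range_self t
      have hab1 := hab.1
      rcases hmem with ⟨s, hs⟩ | hs
      · rw [← hs]; linarith [hγ s]
      -- The new segment is shorter than `R`, so all its `R`-balls contain `X a`.
      · have h2 := hf.sInf_image_le
          (S := closedBall (γ.trans (Path.segment (X a) (X b)) t) R) (x := X a)
          (by rw [mem_closedBall']; linarith [(dist_le_of_mem_segment hdist hs).1])
        linarith⟩
    exact ⟨c, hc, .head ((hGb b).2 rfl) hbc⟩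

end

/-! ### Chernoff bounds for balls centred at sample points. -/

open Classical in
theorem ncard_setOf_eq_sum {ι : Type*} [Fintype ι] (p : ι → Prop) :
    Set.ncard {i | p i} = ∑ i, if p i then 1 else 0 := by
  rw [Set.ncard_eq_toFinset_card', Finset.sum_boole]
  simp

/-- Chernoff's bound for the number of points of an i.i.d. sample in a set. -/
theorem measureReal_pow_le_pow_ncard_le {E : Type*} [MeasurableSpace E] (μ : Measure E)
    [IsProbabilityMeasure μ] {S : Set E} (hS : MeasurableSet S) (m a : ℕ) {w : ℝ} (hw : 0 < w) :
    (Measure.pi fun _ : Fin m => μ).real {Y | w ^ a ≤ w ^ Set.ncard {l | Y l ∈ S}} ≤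
      Real.exp (m * μ.real S * (w - 1)) * (w ^ a)⁻¹ := by
  classical
  -- `w` to the number of hits is a product of independent factors `F (Y l)`; Markov's inequality
  -- then covers both tails, `w > 1` giving the upper and `w < 1` the lower one.
  set F : E → ℝ := fun x => 1 + S.indicator (fun _ => w - 1) x with hF
  have hFint : Integrable (S.indicator fun _ : E => w - 1) μ :=
    (integrable_const _).indicator hS
  have hFval : ∫ x, F x ∂μ = 1 + μ.real S * (w - 1) := by
    rw [hF, integral_add (integrable_const _) hFint, integral_indicator_const _ hS]
    simp
  have hprod : ∀ Y : Fin m → E, w ^ Set.ncard {l | Y l ∈ S} = ∏ l, F (Y l) := by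
    intro Y
    rw [ncard_setOf_eq_sum, ← Finset.prod_pow_eq_pow_sum]
    refine Finset.prod_congr rfl fun l _ => ?_
    by_cases h : Y l ∈ S <;> simp [hF, h]
  have hint : Integrable (fun Y : Fin m → E => ∏ l, F (Y l)) (Measure.pi fun _ : Fin m => μ) :=
    Integrable.fintype_prod fun _ => (integrable_const _).add hFint
  have hmarkov := mul_meas_ge_le_integral_of_nonneg (μ := Measure.pi fun _ : Fin m => μ)
    (f := fun Y : Fin m → E => ∏ l, F (Y l))
    (Eventually.of_forall fun Y => by
      change 0 ≤ ∏ l, F (Y l)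
      rw [← hprod]; exact (pow_pos hw _).le) hint (w ^ a)
  rw [integral_fintype_prod_eq_pow F, hFval, Fintype.card_fin] at hmarkov
  simp_rw [← hprod] at hmarkov
  have h1 : 0 ≤ 1 + μ.real S * (w - 1) := by
    have h0 : 0 ≤ μ.real S := measureReal_nonneg
    have h1 : μ.real S ≤ 1 := measureReal_le_one
    nlinarith
  have h2 : (1 + μ.real S * (w - 1)) ^ m ≤ Real.exp (m * μ.real S * (w - 1)) := by
    calc _ ≤ Real.exp (μ.real S * (w - 1)) ^ m := by
            gcongr; linarith [Real.add_one_le_exp (μ.real S * (w - 1))]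
      _ = _ := by rw [← Real.exp_nat_mul]; ring_nf
  rw [le_mul_inv_iff₀ (pow_pos hw a), mul_comm]
  exact hmarkov.trans h2

/-- Upper tail of the number of sample points in a set. -/
theorem measureReal_le_ncard_le {E : Type*} [MeasurableSpace E] (μ : Measure E)
    [IsProbabilityMeasure μ] {S : Set E} (hS : MeasurableSet S) {m k : ℕ} {e : ℝ} (he : 0 < e)
    (he1 : e < 1) (h : m * μ.real S ≤ (1 - e) * k) :
    (Measure.pi fun _ : Fin m => μ).real {Y | k ≤ 1 + Set.ncard {l | Y l ∈ S}} ≤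
      (Real.exp e * (1 - e)) ^ k / (1 - e) := by
  have h1e : 0 < 1 - e := by linarith
  have hw1 : 1 ≤ (1 - e)⁻¹ := (one_le_inv₀ h1e).2 (by linarith)
  refine (measureReal_mono (fun Y hY => ?_)).trans
    ((measureReal_pow_le_pow_ncard_le μ hS m (k - 1) (inv_pos.2 h1e)).trans ?_)
  · exact pow_le_pow_right₀ hw1 (by have : k ≤ _ := hY; omega)
  · have h2 : Real.exp (m * μ.real S * ((1 - e)⁻¹ - 1)) ≤ Real.exp e ^ k := by
      rw [← Real.exp_nat_mul, Real.exp_le_exp]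
      calc _ ≤ (1 - e) * k * ((1 - e)⁻¹ - 1) := by
            apply mul_le_mul_of_nonneg_right h; linarith
        _ = _ := by field_simp; ring
    -- Only `k - 1` hits besides the centre are needed, at the cost of the factor `1 / (1 - e)`.
    have h3 : (((1 - e)⁻¹) ^ (k - 1))⁻¹ ≤ (1 - e) ^ k / (1 - e) := by
      rw [inv_pow, inv_inv, le_div_iff₀ h1e, ← pow_succ]
      exact pow_le_pow_of_le_one h1e.le (by linarith) (by omega)
    calc _ ≤ Real.exp e ^ k * ((1 - e) ^ k / (1 - e)) := by gcongr
      _ = _ := by rw [mul_pow]; ring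

/-- Lower tail of the number of sample points in a set. -/
theorem measureReal_ncard_lt_le {E : Type*} [MeasurableSpace E] (μ : Measure E)
    [IsProbabilityMeasure μ] {S : Set E} (hS : MeasurableSet S) {m k : ℕ} {e : ℝ} (he : 0 < e)
    (h : (1 + e) * k ≤ m * μ.real S) :
    (Measure.pi fun _ : Fin m => μ).real {Y | 1 + Set.ncard {l | Y l ∈ S} < k} ≤
      (Real.exp (-e) * (1 + e)) ^ k := by
  have h1e : 0 < 1 + e := by linarith
  refine (measureReal_mono (fun Y hY => ?_)).trans
    ((measureReal_pow_le_pow_ncard_le μ hS m k (inv_pos.2 h1e)).trans ?_)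
  · exact pow_le_pow_of_le_one (inv_pos.2 h1e).le (inv_le_one_of_one_le₀ (by linarith))
      (by have : _ < k := hY; omega)
  · have h2 : Real.exp (m * μ.real S * ((1 + e)⁻¹ - 1)) ≤ Real.exp (-e) ^ k := by
      rw [← Real.exp_nat_mul, Real.exp_le_exp]
      have : (1 + e)⁻¹ ≤ 1 := inv_le_one_of_one_le₀ (by linarith)
      calc _ ≤ (1 + e) * k * ((1 + e)⁻¹ - 1) := by
            apply mul_le_mul_of_nonpos_right h; linarith
        _ = _ := by field_simp; ring
    rw [mul_pow, inv_pow, inv_inv]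
    gcongr

/-- Conditioning on one coordinate of an i.i.d. sample. -/
theorem measure_pi_removeNth_le {E : Type*} [MeasurableSpace E] (μ : Measure E)
    [IsProbabilityMeasure μ] {m : ℕ} (j : Fin (m + 1)) {T : Set (E × (Fin m → E))}
    (hT : MeasurableSet T) {q : ENNReal}
    (h : ∀ x, (Measure.pi fun _ : Fin m => μ) {Y | (x, Y) ∈ T} ≤ q) :
    (Measure.pi fun _ : Fin (m + 1) => μ) {X | (X j, fun l => X (j.succAbove l)) ∈ T} ≤ q := by
  have hmp := measurePreserving_piFinSuccAbove (fun _ : Fin (m + 1) => μ) j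
  have := hmp.measure_preimage hT.nullMeasurableSet
  have heq : {X : Fin (m + 1) → E | (X j, fun l => X (j.succAbove l)) ∈ T} =
      (MeasurableEquiv.piFinSuccAbove (fun _ => E) j) ⁻¹' T := rfl
  rw [heq, this, Measure.prod_apply hT]
  calc _ ≤ ∫⁻ _, q ∂μ := lintegral_mono fun x => h x
    _ = q := by simp

/-- The centre lies in its own ball: this is the source of the `1 +` in the tail bounds. -/
theorem ncard_closedBall_eq_add {E : Type*} [PseudoMetricSpace E] {m : ℕ} (X : Fin (m + 1) → E) (j : Fin (m + 1)) {r : ℝ}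
    (hr : 0 ≤ r) : Set.ncard {l | X l ∈ closedBall (X j) r} =
      1 + Set.ncard {l | X (j.succAbove l) ∈ closedBall (X j) r} := by
  classical
  rw [ncard_setOf_eq_sum, ncard_setOf_eq_sum, Fin.sum_univ_succAbove _ j]
  simp [hr]

section
variable {E : Type*} [PseudoMetricSpace E] [SecondCountableTopology E] [MeasurableSpace E]
  [BorelSpace E]

theorem measurable_ncard_closedBall {m : ℕ} {s : E → ℝ} (hs : Measurable s) :
    Measurable fun p : E × (Fin m → E) => Set.ncard {l | p.2 l ∈ closedBall p.1 (s p.1)} := by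
  classical
  simp_rw [ncard_setOf_eq_sum]
  refine Finset.measurable_sum _ fun l _ => Measurable.ite ?_ measurable_const measurable_const
  exact measurableSet_le (f := fun p : E × (Fin m → E) => dist (p.2 l) p.1)
    (g := fun p => s p.1) (by fun_prop) (by fun_prop)

variable (μ : Measure E) [IsProbabilityMeasure μ]

/-- Once its centre is fixed the ball is deterministic and the other `m` points are still i.i.d.; a
union bound over the centres follows. `P` is `Ici k` for one tail and `Iio k` for the other. -/
theorem measure_exists_ncard_closedBall_le {m : ℕ} {s : E → ℝ} (hs : Measurable s)
    (hs0 : ∀ x, 0 ≤ s x) {K : Set E} (hK : MeasurableSet K) (P : Set ℕ) {q : ℝ}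
    (h : ∀ x ∈ K, (Measure.pi fun _ : Fin m => μ).real
      {Y | 1 + Set.ncard {l | Y l ∈ closedBall x (s x)} ∈ P} ≤ q) :
    (Measure.pi fun _ : Fin (m + 1) => μ)
      {X | ∃ j, X j ∈ K ∧ Set.ncard {l | X l ∈ closedBall (X j) (s (X j))} ∈ P} ≤
      ENNReal.ofReal ((m + 1 : ℕ) * q) := by
  have hT : MeasurableSet {p : E × (Fin m → E) | p.1 ∈ K ∧
      1 + Set.ncard {l | p.2 l ∈ closedBall p.1 (s p.1)} ∈ P} :=
    (measurable_fst hK).inter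
      ((measurable_const.add (measurable_ncard_closedBall hs)) (MeasurableSet.of_discrete (s := P)))
  have hj : ∀ j : Fin (m + 1), (Measure.pi fun _ : Fin (m + 1) => μ)
      {X | X j ∈ K ∧ Set.ncard {l | X l ∈ closedBall (X j) (s (X j))} ∈ P} ≤
      ENNReal.ofReal q := by
    intro j
    simp_rw [fun X : Fin (m + 1) → E => ncard_closedBall_eq_add X j (hs0 (X j))]
    refine measure_pi_removeNth_le μ j hT fun x => ?_
    by_cases hx : x ∈ K
    · simp only [mem_ofPred_eq, hx, true_and]
      rw [← ofReal_measureReal]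
      exact ENNReal.ofReal_le_ofReal (h x hx)
    · simp [hx]
  rw [ofPred_exists]
  refine (measure_iUnion_le _).trans ?_
  rw [tsum_fintype]
  calc _ ≤ ∑ _j : Fin (m + 1), ENNReal.ofReal q := Finset.sum_le_sum fun j _ => hj j
    _ = _ := by
      rw [Finset.sum_const, Finset.card_univ, Fintype.card_fin, nsmul_eq_mul,
        ENNReal.ofReal_mul (by positivity), ENNReal.ofReal_natCast]

end

/-- This and the next lemma make the bases of the two Chernoff bounds smaller than 1, by strictness
of `1 + x < exp x`. -/
theorem exp_mul_one_sub_lt_one {e : ℝ} (he : 0 < e) : Real.exp e * (1 - e) < 1 := by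
  have h := Real.add_one_lt_exp (x := -e) (by linarith)
  calc Real.exp e * (1 - e) < Real.exp e * Real.exp (-e) := by gcongr; linarith
    _ = 1 := by rw [← Real.exp_add]; simp

theorem exp_neg_mul_one_add_lt_one {e : ℝ} (he : 0 < e) : Real.exp (-e) * (1 + e) < 1 := by
  have h := Real.add_one_lt_exp (x := e) (by linarith)
  calc Real.exp (-e) * (1 + e) < Real.exp (-e) * Real.exp e := by gcongr; linarith
    _ = 1 := by rw [← Real.exp_add]; simp

/-- A geometric decay in `k` beats `n` as soon as `k` grows faster than `log² n`. -/
theorem tendsto_nat_mul_pow_zero {k : ℕ → ℕ} (hk_pos : ∀ n, 0 < k n)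
    (hk_log : Tendsto (fun n : ℕ => Real.log n ^ 2 / (k n : ℝ)) atTop (𝓝 0))
    {q : ℝ} (hq : 0 < q) (hq1 : q < 1) :
    Tendsto (fun n : ℕ => (n : ℝ) * q ^ k n) atTop (𝓝 0) := by
  have hL : 0 < -Real.log q := neg_pos.2 (Real.log_neg hq hq1)
  refine squeeze_zero' (Eventually.of_forall fun n => by positivity) ?_
    tendsto_one_div_atTop_nhds_zero_nat
  have hlog : Tendsto (fun n : ℕ => Real.log n) atTop atTop :=
    Real.tendsto_log_atTop.comp tendsto_natCast_atTop_atTop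
  filter_upwards [hk_log.eventually (gt_mem_nhds (show (0 : ℝ) < -Real.log q / 2 by linarith)),
    hlog.eventually_ge_atTop 1, eventually_gt_atTop 0] with n h1 h2 h3
  have hk : (0 : ℝ) < k n := by exact_mod_cast hk_pos n
  have hn : (0 : ℝ) < n := by exact_mod_cast h3
  rw [div_lt_iff₀ hk] at h1
  -- Uses `log n ≤ log² n`, valid once `log n ≥ 1`.
  have h4 : (k n : ℝ) * Real.log q ≤ -2 * Real.log n := by nlinarith
  have h5 : q ^ k n ≤ ((n : ℝ) ^ 2)⁻¹ := by
    rw [← Real.exp_log (pow_pos hq (k n)), Real.log_pow,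
      ← Real.exp_log (show (0 : ℝ) < ((n : ℝ) ^ 2)⁻¹ by positivity), Real.exp_le_exp,
      Real.log_inv, Real.log_pow]
    push_cast
    linarith
  calc (n : ℝ) * q ^ k n ≤ n * ((n : ℝ) ^ 2)⁻¹ := by gcongr
    _ = 1 / n := by field_simp

/-! ### Accuracy of the `k`-NN estimator and density of the sample. -/

section
variable {d : ℕ} {f : EuclideanSpace ℝ (Fin d) → ℝ}

theorem IsCompactDensity.isProbabilityMeasure (hf : IsCompactDensity f) :
    IsProbabilityMeasure (densityLaw f) := ⟨by
  rw [densityLaw, withDensity_apply _ MeasurableSet.univ, setLIntegral_univ, hf.lintegral_eq_one]⟩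

theorem densityLaw_real_le {S : Set (EuclideanSpace ℝ (Fin d))} (hS : MeasurableSet S) (hSv : volume S ≠ ⊤) {c : ℝ}
    (hc : 0 ≤ c) (h : ∀ x ∈ S, f x ≤ c) : (densityLaw f).real S ≤ c * volume.real S := by
  rw [measureReal_def, densityLaw, withDensity_apply _ hS, measureReal_def,
    ← ENNReal.toReal_ofReal hc, ← ENNReal.toReal_mul]
  refine ENNReal.toReal_mono (ENNReal.mul_ne_top ENNReal.ofReal_ne_top hSv) ?_
  rw [← setLIntegral_const]
  exact setLIntegral_mono measurable_const fun x hx => ENNReal.ofReal_le_ofReal (h x hx)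

theorem IsCompactDensity.le_densityLaw_real (hf : IsCompactDensity f)
    {S : Set (EuclideanSpace ℝ (Fin d))} (hS : MeasurableSet S) {c : ℝ}
    (hc : 0 ≤ c) (h : ∀ x ∈ S, c ≤ f x) : c * volume.real S ≤ (densityLaw f).real S := by
  have := hf.isProbabilityMeasure
  rw [measureReal_def, measureReal_def, ← ENNReal.toReal_ofReal hc, ← ENNReal.toReal_mul]
  refine ENNReal.toReal_mono (measure_ne_top _ _) ?_
  rw [densityLaw, withDensity_apply _ hS, ← setLIntegral_const]
  exact setLIntegral_mono hf.measurable.ennreal_ofReal fun x hx => ENNReal.ofReal_le_ofReal (h x hx)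

/-- If the ball of radius `s` around `x` has fewer than `k` sample points, `s` bounds the `k`-NN
density from above. -/
theorem knnDensity_le_of_ncard_lt {n k : ℕ} {X : Fin n → EuclideanSpace ℝ (Fin d)} (hd : 0 < d)
    (hn : 0 < n) {x : EuclideanSpace ℝ (Fin d)} {s : ℝ} (hs : 0 < s)
    (h : Set.ncard {j | X j ∈ closedBall x s} < k) :
    knnDensity X k x ≤
      k / (n * volume.real (ball (0 : EuclideanSpace ℝ (Fin d)) 1) * s ^ d) := by
  have hv : 0 < volume.real (ball (0 : EuclideanSpace ℝ (Fin d)) 1) :=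
    ENNReal.toReal_pos (measure_ball_pos _ _ one_pos).ne' measure_ball_lt_top.ne
  have hn' : (0 : ℝ) < n := by exact_mod_cast hn
  rcases Set.eq_empty_or_nonempty {r : ℝ | 0 < r ∧ k ≤ Set.ncard {j | X j ∈ closedBall x r}}
    with he | hne
  -- If no ball has `k` points, the radius is `sInf ∅ = 0` and, as `d > 0`, division by zero makes
  -- the estimate 0.
  · rw [knnDensity, knnRadius, he, Real.sInf_empty, zero_pow hd.ne']
    simp only [mul_zero, div_zero]
    positivity
  · have hle : s ≤ knnRadius X k x := by
      refine le_csInf hne fun r hr => ?_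
      by_contra! hlt
      refine absurd hr.2 (not_le.2 (lt_of_le_of_lt ?_ h))
      exact Set.ncard_le_ncard (fun j hj => closedBall_subset_closedBall hlt.le hj)
        (Set.toFinite _)
    rw [knnDensity]
    gcongr

/-- The second radius `t` excludes a vanishing `k`-NN radius, for which division by zero could make
the estimate 0 instead of infinite. -/
theorem le_knnDensity_of_le_ncard {n k : ℕ} {X : Fin n → EuclideanSpace ℝ (Fin d)}
    (hn : 0 < n) {x : EuclideanSpace ℝ (Fin d)} {s t : ℝ} (hs : 0 < s) (ht : 0 < t)
    (h : k ≤ Set.ncard {j | X j ∈ closedBall x s})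
    (h' : Set.ncard {j | X j ∈ closedBall x t} < k) :
    k / (n * volume.real (ball (0 : EuclideanSpace ℝ (Fin d)) 1) * s ^ d) ≤ knnDensity X k x := by
  have hv : 0 < volume.real (ball (0 : EuclideanSpace ℝ (Fin d)) 1) :=
    ENNReal.toReal_pos (measure_ball_pos _ _ one_pos).ne' measure_ball_lt_top.ne
  have hn' : (0 : ℝ) < n := by exact_mod_cast hn
  have hle : knnRadius X k x ≤ s := csInf_le ⟨0, fun r hr => hr.1.le⟩ ⟨hs, h⟩
  have hpos : 0 < knnRadius X k x := by
    refine ht.trans_le (le_csInf ⟨s, hs, h⟩ fun r hr => ?_)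
    by_contra! hlt
    refine absurd hr.2 (not_le.2 (lt_of_le_of_lt ?_ h'))
    exact Set.ncard_le_ncard (fun j hj => closedBall_subset_closedBall hlt.le hj)
      (Set.toFinite _)
  rw [knnDensity]
  gcongr

/-- The radius of a ball of volume `k / (n y)`. -/
noncomputable def volumeRadius (d n k : ℕ) (y : ℝ) : ℝ :=
  (k / (n * volume.real (ball (0 : EuclideanSpace ℝ (Fin d)) 1) * y)) ^ (d : ℝ)⁻¹

theorem measurable_volumeRadius (d n k : ℕ) : Measurable (volumeRadius d n k) := by
  unfold volumeRadius
  fun_prop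

theorem volumeRadius_pow (hd : 0 < d) (n k : ℕ) {y : ℝ} (hy : 0 ≤ y) :
    volumeRadius d n k y ^ d =
      k / (n * volume.real (ball (0 : EuclideanSpace ℝ (Fin d)) 1) * y) := by
  rw [volumeRadius, Real.rpow_inv_natCast_pow (by positivity) hd.ne']

theorem volumeRadius_pos {n k : ℕ} (hn : 0 < n) (hk : 0 < k) {y : ℝ} (hy : 0 < y) :
    0 < volumeRadius d n k y := by
  have hv : 0 < volume.real (ball (0 : EuclideanSpace ℝ (Fin d)) 1) :=
    ENNReal.toReal_pos (measure_ball_pos _ _ one_pos).ne' measure_ball_lt_top.ne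
  have hn' : (0 : ℝ) < n := by exact_mod_cast hn
  have hk' : (0 : ℝ) < k := by exact_mod_cast hk
  unfold volumeRadius
  positivity

theorem volume_closedBall_volumeRadius (hd : 0 < d) {n k : ℕ} (hn : 0 < n) (hk : 0 < k) {y : ℝ}
    (hy : 0 < y) (x : EuclideanSpace ℝ (Fin d)) :
    volume.real (closedBall x (volumeRadius d n k y)) = k / (n * y) := by
  have hv : 0 < volume.real (ball (0 : EuclideanSpace ℝ (Fin d)) 1) :=
    ENNReal.toReal_pos (measure_ball_pos _ _ one_pos).ne' measure_ball_lt_top.ne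
  have hn' : (0 : ℝ) < n := by exact_mod_cast hn
  rw [Measure.addHaar_real_closedBall _ _ (volumeRadius_pos hn hk hy).le, finrank_euclideanSpace,
    Fintype.card_fin, volumeRadius_pow hd n k hy.le]
  field_simp

theorem volumeRadius_le (hd : 0 < d) {n k : ℕ} {y r : ℝ} (hy : 0 < y) (hr : 0 ≤ r)
    (h : (k : ℝ) / n ≤ volume.real (ball (0 : EuclideanSpace ℝ (Fin d)) 1) * y * r ^ d) :
    volumeRadius d n k y ≤ r := by
  have hv : 0 < volume.real (ball (0 : EuclideanSpace ℝ (Fin d)) 1) :=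
    ENNReal.toReal_pos (measure_ball_pos _ _ one_pos).ne' measure_ball_lt_top.ne
  refine le_of_pow_le_pow_left₀ hd.ne' hr ?_
  rw [volumeRadius_pow hd n k hy.le, mul_assoc, ← div_div, div_le_iff₀ (by positivity)]
  linarith

theorem div_div_mul_volumeRadius (hd : 0 < d) {n k : ℕ} (hn : 0 < n) (hk : 0 < k) {y : ℝ}
    (hy : 0 < y) : (k : ℝ) / (n * volume.real (ball (0 : EuclideanSpace ℝ (Fin d)) 1) *
      volumeRadius d n k y ^ d) = y := by
  have hv : 0 < volume.real (ball (0 : EuclideanSpace ℝ (Fin d)) 1) :=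
    ENNReal.toReal_pos (measure_ball_pos _ _ one_pos).ne' measure_ball_lt_top.ne
  have hn' : (0 : ℝ) < n := by exact_mod_cast hn
  have hk' : (0 : ℝ) < k := by exact_mod_cast hk
  rw [volumeRadius_pow hd n k hy.le]
  field_simp

/-- Provides the measurability of the set of deep points. -/
theorem isClosed_setOf_closedBall_subset {S : Set (EuclideanSpace ℝ (Fin d))} (hS : IsClosed S)
    (r : ℝ) : IsClosed {x | closedBall x r ⊆ S} := by
  have : {x | closedBall x r ⊆ S} = ⋂ v ∈ closedBall (0 : EuclideanSpace ℝ (Fin d)) r,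
      (fun x => x + v) ⁻¹' S := by
    ext x
    simp only [mem_ofPred_eq, mem_iInter, mem_preimage]
    constructor
    · intro h v hv
      exact h (by simpa using hv)
    · intro h y hy
      simpa using h (y - x) (by simpa [dist_eq_norm] using hy)
  rw [this]
  exact isClosed_biInter fun v _ => hS.preimage (by fun_prop)

/-- The sample is eventually dense at any fixed scale inside the support. -/
theorem IsCompactDensity.tendsto_measure_not_dense (hf : IsCompactDensity f) {lam₀ : ℝ} (hlam₀ : 0 < lam₀)
    (hlower : ∀ x ∈ tsupport f, lam₀ ≤ f x) {r : ℝ} (hr : 0 < r) :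
    Tendsto (fun n : ℕ => (Measure.pi fun _ : Fin n => densityLaw f)
      {X | ¬ ∀ y, closedBall y r ⊆ tsupport f → ∃ j, dist (X j) y ≤ r}) atTop (𝓝 0) := by
  have := hf.isProbabilityMeasure
  obtain ⟨T, -, hTfin, hTcov⟩ := hf.compact_support.isCompact.finite_cover_balls
    (show 0 < r / 2 by positivity)
  -- Balls of the cover that stay in the support have positive mass, so each is missed with
  -- geometrically small probability; every deep `y` lies in one of them.
  set T' := {c ∈ T | ball c (r / 2) ⊆ tsupport f} with hT'
  have hT'fin : T'.Finite := hTfin.subset (sep_subset _ _)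
  lift T' to Finset (EuclideanSpace ℝ (Fin d)) using hT'fin with S
  have hbound : ∀ n : ℕ, (Measure.pi fun _ : Fin n => densityLaw f)
      {X | ¬ ∀ y, closedBall y r ⊆ tsupport f → ∃ j, dist (X j) y ≤ r} ≤
      ∑ c ∈ S, densityLaw f (ball c (r / 2))ᶜ ^ n := by
    intro n
    refine le_trans (measure_mono (t := ⋃ c ∈ S, univ.pi fun _ : Fin n => (ball c (r / 2))ᶜ) ?_)
      ((measure_biUnion_finset_le _ _).trans (Finset.sum_le_sum fun c _ => ?_))
    · intro X hX
      simp only [mem_ofPred_eq, not_forall, not_exists, not_le] at hX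
      obtain ⟨y, hy, hX⟩ := hX
      obtain ⟨c, hc, hyc⟩ := mem_iUnion₂.1 (hTcov (hy (mem_closedBall_self hr.le)))
      have hyc' : dist y c < r / 2 := hyc
      have hcS : c ∈ S := by
        rw [← Finset.mem_coe, hT']
        refine ⟨hc, fun z hz => hy ?_⟩
        have hz' : dist z c < r / 2 := hz
        have := dist_triangle_right z y c
        rw [mem_closedBall]; linarith
      refine mem_iUnion₂.2 ⟨c, hcS, fun j _ hj => ?_⟩
      have hj' : dist (X j) c < r / 2 := hj
      have := dist_triangle_right (X j) y c
      linarith [hX j]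
    · rw [Measure.pi_pi]; simp
  refine tendsto_of_tendsto_of_tendsto_of_le_of_le tendsto_const_nhds ?_ (fun _ => zero_le) hbound
  rw [← Finset.sum_const_zero (s := S) (M := ENNReal)]
  refine tendsto_finsetSum _ fun c hc => ENNReal.tendsto_pow_atTop_nhds_zero_of_lt_one ?_
  have hc' : ball c (r / 2) ⊆ tsupport f := by
    rw [← Finset.mem_coe, hT'] at hc
    exact hc.2
  have hpos : 0 < densityLaw f (ball c (r / 2)) := by
    have h1 := hf.le_densityLaw_real (measurableSet_ball (x := c) (ε := r / 2)) hlam₀.le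
      fun x hx => hlower x (hc' hx)
    have h2 : 0 < volume.real (ball c (r / 2)) :=
      ENNReal.toReal_pos (measure_ball_pos _ _ (by positivity)).ne' measure_ball_lt_top.ne
    exact (ENNReal.toReal_pos_iff.1 (lt_of_lt_of_le (by positivity) h1)).1
  rw [prob_compl_eq_one_sub measurableSet_ball]
  exact ENNReal.sub_lt_self ENNReal.one_ne_top one_ne_zero (ne_of_gt hpos)

/-- With probability tending to one no ball of `f`-mass slightly below `k / n` centred at a sample
point contains `k` sample points. -/
theorem IsCompactDensity.tendsto_measure_upper (hd : 0 < d) (hf : IsCompactDensity f) {B : ℝ}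
    (hB0 : 0 < B) (hB : ∀ x, f x ≤ B)
    {ε r : ℝ} (hε : 0 < ε) (hr : 0 < r)
    (huc : ∀ x ∈ tsupport f, ∀ y ∈ tsupport f, dist x y ≤ r → |f x - f y| ≤ ε / 2)
    {k : ℕ → ℕ} (hk_pos : ∀ n, 0 < k n)
    (hk_log : Tendsto (fun n : ℕ => Real.log n ^ 2 / (k n : ℝ)) atTop (𝓝 0))
    (hk_n : Tendsto (fun n : ℕ => (k n : ℝ) / (n : ℝ)) atTop (𝓝 0)) :
    Tendsto (fun n : ℕ => (Measure.pi fun _ : Fin n => densityLaw f)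
      {X | ∃ j, X j ∈ tsupport f ∧ Set.ncard {l | X l ∈ closedBall (X j)
        (volumeRadius d n (k n) (f (X j) + ε))} ∈ Ici (k n)}) atTop (𝓝 0) := by
  have := hf.isProbabilityMeasure
  have hv : 0 < volume.real (ball (0 : EuclideanSpace ℝ (Fin d)) 1) :=
    ENNReal.toReal_pos (measure_ball_pos _ _ one_pos).ne' measure_ball_lt_top.ne
  -- Chosen so that `f x + ε / 2 ≤ (1 - e) * (f x + ε)` for all values `f x ≤ B`.
  set e := ε / (2 * (B + ε)) with he
  have he0 : 0 < e := by positivity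
  have he1 : e < 1 := by rw [he, div_lt_one (by positivity)]; linarith
  set q := Real.exp e * (1 - e) with hq
  have hq0 : 0 < q := mul_pos (Real.exp_pos _) (by linarith)
  have hlim : Tendsto (fun n : ℕ => ENNReal.ofReal (n * (q ^ k n / (1 - e)))) atTop (𝓝 0) := by
    rw [← ENNReal.ofReal_zero]
    refine (ENNReal.continuous_ofReal.tendsto 0).comp ?_
    simpa [mul_div_assoc] using
      (tendsto_nat_mul_pow_zero hk_pos hk_log hq0 (exp_mul_one_sub_lt_one he0)).div_const (1 - e)
  refine tendsto_of_tendsto_of_tendsto_of_le_of_le' tendsto_const_nhds hlim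
    (Eventually.of_forall fun _ => zero_le) ?_
  filter_upwards [hk_n.eventually (ge_mem_nhds (show (0 : ℝ) <
    volume.real (ball (0 : EuclideanSpace ℝ (Fin d)) 1) * ε * r ^ d by positivity)),
    eventually_gt_atTop 0] with n hkn hn
  obtain ⟨m, rfl⟩ := Nat.exists_eq_succ_of_ne_zero hn.ne'
  have hypos : ∀ x, 0 < f x + ε := fun x => by linarith [hf.nonneg x]
  refine measure_exists_ncard_closedBall_le (densityLaw f)
    (s := fun x => volumeRadius d (m + 1) (k (m + 1)) (f x + ε))
    ((measurable_volumeRadius d _ _).comp (hf.measurable.add_const ε))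
    (fun x => (volumeRadius_pos hn (hk_pos _) (hypos x)).le)
    (isClosed_tsupport f).measurableSet (Ici (k (m + 1))) fun x hx => ?_
  refine measureReal_le_ncard_le _ measurableSet_closedBall he0 he1 ?_
  have hn' : (0 : ℝ) < (m + 1 : ℕ) := by exact_mod_cast hn
  have hk0 : (0 : ℝ) < k (m + 1) := by exact_mod_cast hk_pos _
  have hle : volumeRadius d (m + 1) (k (m + 1)) (f x + ε) ≤ r := by
    refine volumeRadius_le hd (hypos x) hr.le (hkn.trans ?_)
    gcongr
    linarith [hf.nonneg x]
  have hlaw := densityLaw_real_le (f := f) (measurableSet_closedBall (x := x)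
    (ε := volumeRadius d (m + 1) (k (m + 1)) (f x + ε))) measure_closedBall_lt_top.ne
    (c := f x + ε / 2) (by linarith [hf.nonneg x]) (fun y hy => by
      by_cases hyX : y ∈ tsupport f
      · have := abs_le.1 (huc y hyX x hx ((mem_closedBall.1 hy).trans hle))
        linarith
      · rw [image_eq_zero_of_notMem_tsupport hyX]; linarith [hf.nonneg x])
  rw [volume_closedBall_volumeRadius hd hn (hk_pos _) (hypos x)] at hlaw
  have hratio : f x + ε / 2 ≤ (1 - e) * (f x + ε) := by
    have h1 : e * (f x + ε) ≤ ε / 2 := by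
      calc e * (f x + ε) ≤ e * (B + ε) := by gcongr; exact hB x
        _ = ε / 2 := by rw [he]; field_simp
    linarith
  have hy := hypos x
  calc (m : ℝ) * _ ≤ (m + 1 : ℕ) * ((f x + ε / 2) * (k (m + 1) / ((m + 1 : ℕ) * (f x + ε)))) := by
        gcongr; omega
    _ ≤ (m + 1 : ℕ) * ((1 - e) * (f x + ε) * (k (m + 1) / ((m + 1 : ℕ) * (f x + ε)))) := by gcongr
    _ = _ := by field_simp

/-- With probability tending to one each ball of `f`-mass slightly above `k / n` centred at a
sample point deep in the support contains `k` sample points. -/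
theorem IsCompactDensity.tendsto_measure_lower (hd : 0 < d) (hf : IsCompactDensity f) {B : ℝ}
    (hB0 : 0 < B) (hB : ∀ x, f x ≤ B)
    {lam₀ : ℝ} (hlower : ∀ x ∈ tsupport f, lam₀ ≤ f x)
    {ε r : ℝ} (hε : 0 < ε) (hεlam : ε ≤ lam₀ / 2) (hr : 0 < r)
    (huc : ∀ x ∈ tsupport f, ∀ y ∈ tsupport f, dist x y ≤ r → |f x - f y| ≤ ε / 2)
    {k : ℕ → ℕ} (hk_pos : ∀ n, 0 < k n)
    (hk_log : Tendsto (fun n : ℕ => Real.log n ^ 2 / (k n : ℝ)) atTop (𝓝 0))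
    (hk_n : Tendsto (fun n : ℕ => (k n : ℝ) / (n : ℝ)) atTop (𝓝 0)) :
    Tendsto (fun n : ℕ => (Measure.pi fun _ : Fin n => densityLaw f)
      {X | ∃ j, X j ∈ {x | closedBall x r ⊆ tsupport f} ∧ Set.ncard {l | X l ∈ closedBall (X j)
        (volumeRadius d n (k n) (max (f (X j) - ε) ε))} ∈ Iio (k n)}) atTop (𝓝 0) := by
  have := hf.isProbabilityMeasure
  have hv : 0 < volume.real (ball (0 : EuclideanSpace ℝ (Fin d)) 1) :=
    ENNReal.toReal_pos (measure_ball_pos _ _ one_pos).ne' measure_ball_lt_top.ne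
  -- Gives the ratio `1 + 2 * e`; half of this margin pays for having `m = n - 1` points besides the
  -- centre instead of `n`.
  set e := ε / (4 * B) with he
  have he0 : 0 < e := by positivity
  set q := Real.exp (-e) * (1 + e) with hq
  have hq0 : 0 < q := mul_pos (Real.exp_pos _) (by linarith)
  have hlim : Tendsto (fun n : ℕ => ENNReal.ofReal (n * q ^ k n)) atTop (𝓝 0) := by
    rw [← ENNReal.ofReal_zero]
    exact (ENNReal.continuous_ofReal.tendsto 0).comp
      (tendsto_nat_mul_pow_zero hk_pos hk_log hq0 (exp_neg_mul_one_add_lt_one he0))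
  refine tendsto_of_tendsto_of_tendsto_of_le_of_le' tendsto_const_nhds hlim
    (Eventually.of_forall fun _ => zero_le) ?_
  filter_upwards [hk_n.eventually (ge_mem_nhds (show (0 : ℝ) <
    volume.real (ball (0 : EuclideanSpace ℝ (Fin d)) 1) * ε * r ^ d by positivity)),
    eventually_gt_atTop 0, (tendsto_natCast_atTop_atTop (R := ℝ)).eventually_ge_atTop
      ((1 + 2 * e) / e)] with n hkn hn hne
  obtain ⟨m, rfl⟩ := Nat.exists_eq_succ_of_ne_zero hn.ne'
  -- The maximum keeps the radius meaningful at every `x`; on the support it equals `f x - ε`,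
  -- because `ε ≤ lam₀ / 2`.
  have hypos : ∀ x, 0 < max (f x - ε) ε := fun x => lt_max_of_lt_right hε
  refine measure_exists_ncard_closedBall_le (densityLaw f)
    (s := fun x => volumeRadius d (m + 1) (k (m + 1)) (max (f x - ε) ε))
    ((measurable_volumeRadius d _ _).comp ((hf.measurable.sub_const ε).max measurable_const))
    (fun x => (volumeRadius_pos hn (hk_pos _) (hypos x)).le)
    (isClosed_setOf_closedBall_subset (isClosed_tsupport f) r).measurableSet
    (Iio (k (m + 1))) fun x hx => ?_
  refine measureReal_ncard_lt_le _ measurableSet_closedBall he0 ?_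
  have hn' : (0 : ℝ) < (m + 1 : ℕ) := by exact_mod_cast hn
  have hk0 : (0 : ℝ) < k (m + 1) := by exact_mod_cast hk_pos _
  have hle : volumeRadius d (m + 1) (k (m + 1)) (max (f x - ε) ε) ≤ r := by
    refine volumeRadius_le hd (hypos x) hr.le (hkn.trans ?_)
    gcongr
    exact le_max_right _ _
  have hxX : x ∈ tsupport f := hx (mem_closedBall_self hr.le)
  have hfx : lam₀ ≤ f x := hlower x hxX
  have hmax : max (f x - ε) ε = f x - ε := max_eq_left (by linarith)
  have hy : 0 < f x - ε := by linarith
  have hlaw := hf.le_densityLaw_real (measurableSet_closedBall (x := x)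
    (ε := volumeRadius d (m + 1) (k (m + 1)) (max (f x - ε) ε)))
    (c := f x - ε / 2) (by linarith) (fun y hy => by
      have hyr := (mem_closedBall.1 hy).trans hle
      have := abs_le.1 (huc y (hx hyr) x hxX hyr)
      linarith)
  rw [volume_closedBall_volumeRadius hd hn (hk_pos _) (hypos x), hmax] at hlaw
  rw [hmax]
  have hratio : (1 + 2 * e) * (f x - ε) ≤ f x - ε / 2 := by
    have h1 : 2 * e * (f x - ε) ≤ ε / 2 := by
      calc 2 * e * (f x - ε) ≤ 2 * e * B := by gcongr; linarith [hB x]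
        _ = ε / 2 := by rw [he]; field_simp; norm_num
    linarith
  have hm : (1 + e) * (m + 1 : ℕ) ≤ m * (1 + 2 * e) := by
    rw [div_le_iff₀ he0] at hne
    push_cast at hne ⊢
    linarith
  calc (1 + e) * (k (m + 1) : ℝ) = (1 + e) * (m + 1 : ℕ) * (k (m + 1) / (m + 1 : ℕ)) := by
        field_simp
    _ ≤ m * (1 + 2 * e) * (k (m + 1) / (m + 1 : ℕ)) := by gcongr
    _ = m * ((1 + 2 * e) * (f x - ε) * (k (m + 1) / ((m + 1 : ℕ) * (f x - ε)))) := by field_simp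
    _ ≤ m * ((f x - ε / 2) * (k (m + 1) / ((m + 1 : ℕ) * (f x - ε)))) := by gcongr
    _ ≤ _ := by gcongr

/-- A sample is representative with probability tending to one. -/
theorem IsCompactDensity.tendsto_measure_not_isRepresentative (hd : 0 < d)
    (hf : IsCompactDensity f) {B : ℝ} (hB0 : 0 < B) (hB : ∀ x, f x ≤ B)
    {lam₀ : ℝ} (hlam₀ : 0 < lam₀) (hlower : ∀ x ∈ tsupport f, lam₀ ≤ f x)
    {ε r : ℝ} (hε : 0 < ε) (hεlam : ε ≤ lam₀ / 2) (hr : 0 < r)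
    (huc : ∀ x ∈ tsupport f, ∀ y ∈ tsupport f, dist x y ≤ r → |f x - f y| ≤ ε / 2)
    {k : ℕ → ℕ} (hk_pos : ∀ n, 0 < k n)
    (hk_log : Tendsto (fun n : ℕ => Real.log n ^ 2 / (k n : ℝ)) atTop (𝓝 0))
    (hk_n : Tendsto (fun n : ℕ => (k n : ℝ) / (n : ℝ)) atTop (𝓝 0)) :
    Tendsto (fun n : ℕ => (Measure.pi fun _ : Fin n => densityLaw f)
      {X | ¬ IsRepresentative f (k n) ε r X}) atTop (𝓝 0) := by
  have h1 := hf.tendsto_measure_not_dense hlam₀ hlower hr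
  have h2 := IsCompactDensity.tendsto_measure_upper hd hf hB0 hB hε hr huc hk_pos hk_log hk_n
  have h3 := IsCompactDensity.tendsto_measure_lower hd hf hB0 hB hlower hε hεlam hr huc hk_pos hk_log hk_n
  have h := (h1.add h2).add h3
  simp only [add_zero] at h
  refine tendsto_of_tendsto_of_tendsto_of_le_of_le' tendsto_const_nhds h
    (Eventually.of_forall fun _ => zero_le) ?_
  filter_upwards [eventually_gt_atTop 0] with n hn
  refine (measure_mono ?_).trans ((measure_union_le _ _).trans
    (add_le_add (measure_union_le _ _) le_rfl))
  intro X hX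
  by_contra hcon
  simp only [mem_union, not_or] at hcon
  obtain ⟨⟨hN, hU⟩, hL⟩ := hcon
  simp only [mem_ofPred_eq, not_not, not_exists, not_and, mem_Ici, mem_Iio, not_le, not_lt]
    at hN hU hL
  have hyU : ∀ x, 0 < f x + ε := fun x => by linarith [hf.nonneg x]
  refine hX ⟨fun j hj => ?_, fun j hj => ?_, hN⟩
  · exact (knnDensity_le_of_ncard_lt hd hn (volumeRadius_pos hn (hk_pos n) (hyU _))
      (hU j hj)).trans_eq (div_div_mul_volumeRadius hd hn (hk_pos n) (hyU _))
  · have hjX : X j ∈ tsupport f := hj (mem_closedBall_self hr.le)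
    have hy : 0 < max (f (X j) - ε) ε := lt_max_of_lt_right hε
    exact (le_max_left _ _).trans ((div_div_mul_volumeRadius hd hn (hk_pos n) hy).symm.trans_le
      (le_knnDensity_of_le_ncard hn (volumeRadius_pos hn (hk_pos n) hy)
      (volumeRadius_pos hn (hk_pos n) (hyU _)) (hL j hj) (hU j hjX)))

end

/-! ### Choice of scales and conclusion. -/

theorem theorem2 {d : ℕ} (hd : 0 < d)
    (f : EuclideanSpace ℝ (Fin d) → ℝ) (hf : IsCompactDensity f)
    -- `f` is continuously differentiable and bounded below on its support
    (gradf : EuclideanSpace ℝ (Fin d) → EuclideanSpace ℝ (Fin d))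
    (hgrad : IsGradientOnSupport f gradf)
    (lam₀ : ℝ) (hlam₀ : 0 < lam₀) (hlower : ∀ x ∈ tsupport f, lam₀ ≤ f x)
    -- `M 0, …, M (C - 1)` are the cluster-cores of `f`
    (β : ℝ) (hβ₀ : 0 < β) (hβ₁ : β < 1)
    (C : ℕ) (M : Fin C → Set (EuclideanSpace ℝ (Fin d)))
    (hM_inj : Function.Injective M) (hM : Set.range M = {S | IsClusterCore f β S})
    (hM_null : ∀ i, volume (frontier (M i)) = 0)
    -- the cluster-cores are in the interior of their attraction regions
    (R₀ : ℝ) (hR₀ : 0 < R₀)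
    (hinterior : ∀ i, Metric.cthickening R₀ (M i) ⊆ attractionRegion f gradf (M i))
    -- regularity of the level sets
    (hcont : LevelSetsUniformlyContinuous f) (hthick : LevelSetsThick f M)
    (R ρ δ : ℝ) (hR : 0 < R) (hRR₀ : R < R₀) (hρ : 0 < ρ) (hδ : 0 < δ)
    (k : ℕ → ℕ) (hk_pos : ∀ n, 0 < k n)
    (hk_log : Tendsto (fun n : ℕ => Real.log n ^ 2 / (k n : ℝ)) atTop (𝓝 0))
    (hk_n : Tendsto (fun n : ℕ => (k n : ℝ) / (n : ℝ)) atTop (𝓝 0)) :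
    ∃ N : ℕ, ∀ n ≥ N, ∃ Ω : Set (Fin n → EuclideanSpace ℝ (Fin d)),
      MeasurableSet Ω ∧
      1 - ENNReal.ofReal (2 * δ) ≤ Measure.pi (fun _ : Fin n => densityLaw f) Ω ∧
      ∀ X ∈ Ω, ∀ τ : Equiv.Perm (Fin n), SortsByKnnDensity X (k n) τ →
        ∀ Mhat : Fin C → Set (Fin n), Function.Injective Mhat →
          Set.range Mhat = mcores X (k n) β τ →
          (∀ i, {j | X j ∈ M i} ⊆ Mhat i ∧ ∀ j ∈ Mhat i, X j ∈ Metric.cthickening (R / 4) (M i)) →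
          ∀ G : Fin n → Fin n → Prop, IsQuickshiftGraph X (k n) (mcores X (k n) β τ) G →
            ∀ (i : Fin C) (j : Fin n),
              X j ∈ regionInterior f R ρ (attractionRegion f gradf (M i)) →
                j ∈ quickshiftCluster G (Mhat i) := by

  have hcontf := hgrad.continuousOn
  obtain ⟨B, hB0, hB⟩ := hf.bddAbove hcontf
  have hcore : ∀ i, IsClusterCore f β (M i) := fun i => by
    have : M i ∈ {S | IsClusterCore f β S} := hM ▸ mem_range_self i
    exact this
  obtain ⟨η, hη, hinc⟩ := exists_uniform_increase hf hgrad hlam₀ hlower hβ₀ hβ₁ hcore hM_null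
    hcont hthick (show 0 < R / 8 by positivity)
  -- `η / 4` lets the increase survive three errors, `ρ / 4` makes two errors at most `ρ / 2`, and
  -- `lam₀ / 2` keeps `f - ε` at least `ε` on the support.
  obtain ⟨ε, hε, hεη, hερ, hεlam⟩ : ∃ ε : ℝ, 0 < ε ∧ ε ≤ η / 4 ∧ ε ≤ ρ / 4 ∧ ε ≤ lam₀ / 2 :=
    ⟨min (min (η / 4) (ρ / 4)) (lam₀ / 2), by positivity,
      (min_le_left _ _).trans (min_le_left _ _), (min_le_left _ _).trans (min_le_right _ _),
      min_le_right _ _⟩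
  obtain ⟨r₁, hr₁, huc₁⟩ := Metric.uniformContinuousOn_iff.1
    (hf.compact_support.isCompact.uniformContinuousOn_of_continuous hcontf) (ε / 2) (by positivity)
  obtain ⟨r, hr, hrR, hrr₁⟩ : ∃ r : ℝ, 0 < r ∧ r ≤ R / 16 ∧ r < r₁ :=
    ⟨min (R / 16) (r₁ / 2), by positivity, min_le_left _ _,
      (min_le_right _ _).trans_lt (by linarith)⟩
  have huc : ∀ x ∈ tsupport f, ∀ y ∈ tsupport f, dist x y ≤ r → |f x - f y| ≤ ε / 2 :=
    fun x hx y hy hxy => (huc₁ x hx y hy (hxy.trans_lt hrr₁)).le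
  have hlim := IsCompactDensity.tendsto_measure_not_isRepresentative hd hf hB0 hB hlam₀ hlower hε
    hεlam hr huc hk_pos hk_log hk_n
  obtain ⟨N, hN⟩ := eventually_atTop.1 (hlim.eventually
    (ge_mem_nhds (ENNReal.ofReal_pos.2 (show 0 < 2 * δ by positivity))))
  have := hf.isProbabilityMeasure
  -- A measurable hull of the bad samples has the same measure, so measurability of the bad event
  -- itself is not needed.
  refine ⟨N, fun n hn => ⟨(toMeasurable (Measure.pi fun _ : Fin n => densityLaw f)
    {X | ¬ IsRepresentative f (k n) ε r X})ᶜ, (measurableSet_toMeasurable _ _).compl, ?_, ?_⟩⟩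
  · rw [prob_compl_eq_one_sub (measurableSet_toMeasurable _ _), measure_toMeasurable]
    exact tsub_le_tsub_left (hN n hn) 1
  · intro X hX τ _ Mhat _ hcores hMhat G hG i j hj
    have hrep : IsRepresentative f (k n) ε r X := by
      by_contra hcon
      exact hX (subset_toMeasurable _ _ hcon)
    exact hrep.mem_quickshiftCluster hf hB hβ₁ hM_inj hcore hR hρ
      (fun i => (cthickening_mono (by linarith) _).trans (hinterior i)) hinc hr hrR hε hεη hερ
      (fun x hx y hy hxy => (huc x hx y hy hxy).trans (by linarith)) hcores hMhat hG hj
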